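/- Let $q>0$, and consider on $\mathbb{R}^3$ the repulsive Kepler system $$\dot{x}=v,\qquad \dot v=\frac q2\frac{x}{|x|^3}, \tag{ODE}$$ with energy $H(x,v)=|v|^2+\frac{q}{|x|}$. Put $\mathcal{P}_{x,v}=\{(x,v)\in\mathbb{R}^3\times\mathbb{R}^3:|x|>0\}$ and $\mathcal{P}_{\vartheta,a}=\{(\vartheta,a)\in\mathbb{R}^3\times\mathbb{R}^3:|a|>0\}$. For $x,a\neq 0$ and $s\ge 1$ put $$\rho(x,a)=\frac{|a|}{2q}\left(x\cdot a+|x||a|\right),\qquad K(s)=\sqrt{s(s-1)}-\ln\left(\sqrt s+\sqrt{s-1}\right),$$ and, where $\rho(x,a)\ge 1$, $$S_\pm(x,a)=\pm\frac{q}{|a|}K(\rho(x,a))-\frac{|x||a|-x\cdot a}{2}.$$ There exists a smooth ($C^\infty$) diffeomorphism $T:\mathcal{P}_{x,v}\to\mathcal{P}_{\vartheta,a}$, $(x,v)\mapsto(\Theta(x,v),\mathcal{A}(x,v))$, with smooth inverse $(\vartheta,a)\mapsto(X(\vartheta,a),V(\vartheta,a))$, such that: 1. $T$ is canonical, i.e.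 $\sum_j dx_j\wedge dv_j=\sum_j d\Theta_j\wedge d\mathcal{A}_j$ on $\mathcal{P}_{x,v}$. 2. For all $(x,v)\in\mathcal{P}_{x,v}$: $H(x,v)=|\mathcal{A}(x,v)|^2$ and $x\times v=\Theta(x,v)\times\mathcal{A}(x,v)$. 3. $T$ linearizes the flow: for every interval $I\subseteq\mathbb{R}$ with $0\in I$, a curve $(x(t),v(t))_{t\in I}$ in $\mathcal{P}_{x,v}$ solves (ODE) on $I$ if and only if, for all $t\in I$, $$\Theta(x(t),v(t))=\Theta(x(0),v(0))+t\,\mathcal{A}(x(0),v(0)),\qquad \mathcal{A}(x(t),v(t))=\mathcal{A}(x(0),v(0)).$$ 4. $T$ has the asymptotic action property: for every $(\vartheta,a)\in\mathcal{P}_{\vartheta,a}$, as $t\to+\infty$, $$|X(\vartheta+ta,a)-ta|=o(t),\qquad |V(\vartheta+ta,a)-a|=o(1).$$ 5. $T$ is obtained by gluing the maps generated by $S_-$ and $S_+$ across the fold $\Gamma=\{x\cdot v=-\sqrt{H}\,|x\times v|^2/q\}$: for $(x,v)\in\mathcal{P}_{x,v}$ and $a=\mathcal{A}(x,v)$ one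 has $\rho(x,a)\ge 1$, with equality if and only if $(x,v)\in\Gamma$; moreover $$v=\nabla_xS_\iota(x,a),\qquad \Theta(x,v)=\nabla_aS_\iota(x,a),$$ where $\iota=-$ if $x\cdot v<-\sqrt{H}\,|x\times v|^2/q$, and $\iota=+$ if $x\cdot v>-\sqrt{H}\,|x\times v|^2/q$. -/

import Mathlib

open Set Filter Topology Asymptotics
open scoped ContDiff

noncomputable section

namespace Kepler

/-- Three-dimensional Euclidean space. -/
abbrev E3 : Type := EuclideanSpace ℝ (Fin 3)

/-- The cross product of two vectors of Euclidean three-space. -/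
def cross (x y : E3) : E3 := WithLp.toLp 2 (crossProduct x.ofLp y.ofLp)

/-- The phase space of positions and velocities `(x, v)` with `|x| > 0`. -/
def physicalPhaseSpace : Set (E3 × E3) := {z | 0 < ‖z.1‖}

/-- The phase space of angles and actions `(ϑ, a)` with `|a| > 0`. -/
def actionAnglePhaseSpace : Set (E3 × E3) := {w | 0 < ‖w.2‖}

/-- The energy `H(x, v) = |v|² + q / |x|`. -/
def energy (q : ℝ) (x v : E3) : ℝ := ‖v‖ ^ 2 + q / ‖x‖

/-- The curve `(x(t), v(t))` solves `ẋ = v`, `v̇ = (q/2) x / |x|³` on the set of times `I`. -/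
def SolvesKeplerOn (q : ℝ) (I : Set ℝ) (x v : ℝ → E3) : Prop :=
  ∀ t ∈ I, HasDerivWithinAt x (v t) I t ∧
    HasDerivWithinAt v ((q / 2 / ‖x t‖ ^ 3) • x t) I t

/-- The canonical two-form `∑ⱼ dpⱼ ∧ drⱼ` in the coordinates `(p, r)` of `ℝ³ × ℝ³`. -/
def canonicalForm (ξ ζ : E3 × E3) : ℝ :=
  ∑ j : Fin 3, (ξ.1 j * ζ.2 j - ξ.2 j * ζ.1 j)

/-- The map `T` pulls the canonical two-form back to itself at every point of `U`. -/
def IsCanonicalOn (T : E3 × E3 → E3 × E3) (U : Set (E3 × E3)) : Prop :=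
  ∀ z ∈ U, ∀ ξ ζ : E3 × E3,
    canonicalForm (fderiv ℝ T z ξ) (fderiv ℝ T z ζ) = canonicalForm ξ ζ

/-- `K(s) = √(s(s-1)) - ln(√s + √(s-1))`, used for `s ≥ 1`. -/
def K (s : ℝ) : ℝ := √(s * (s - 1)) - Real.log (√s + √(s - 1))

/-- `ρ(x, a) = (|a| / 2q) (x·a + |x||a|)`. -/
def rho (q : ℝ) (x a : E3) : ℝ := ‖a‖ / (2 * q) * (inner ℝ x a + ‖x‖ * ‖a‖)

/-- The generating functions `S_ι(x, a) = ι (q / |a|) K(ρ(x, a)) - (|x||a| - x·a) / 2`,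
with `ι = 1` for `S_+` and `ι = -1` for `S_-`. -/
def generating (q ι : ℝ) (x a : E3) : ℝ :=
  ι * (q / ‖a‖) * K (rho q x a) - (‖x‖ * ‖a‖ - inner ℝ x a) / 2

/-- The function `x·v + √H L² / q`, with `L = |x × v|`: it vanishes exactly on the fold, is negative
before the fold and positive after it. -/
def foldFunction (q : ℝ) (x v : E3) : ℝ :=
  inner ℝ x v + √(energy q x v) * ‖cross x v‖ ^ 2 / q

/-- At `(x, v)`, the map `T = (Θ, 𝒜)` is generated by `S_ι`:
`v = ∇ₓ S_ι(x, a)` and `Θ(x, v) = ∇ₐ S_ι(x, a)` for `a = 𝒜(x, v)`. -/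
def GeneratedAt (q ι : ℝ) (T : E3 × E3 → E3 × E3) (x v : E3) : Prop :=
  HasGradientAt (fun y => generating q ι y (T (x, v)).2) v x ∧
    HasGradientAt (fun b => generating q ι x b) (T (x, v)).1 (T (x, v)).2

end Kepler

end

/-!
Write `α = √H` and `w = (2α / q)(x·v + α|x|) - 1`, which is positive because `|v| < α`. The action
`𝒜 = v + w⁻¹(v + α x/|x|)` has length `α`, and at `a = 𝒜(x, v)` one finds `ρ = (w + 1)² / (4w)`, so
the fold is `w = 1`. Since `±K(ρ) = (w - w⁻¹)/4 - (log w)/2` with the sign of `w - 1`, the two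
generating functions are the two halves of one function, whose value at corresponding points is
`S = x·v - (q / 2α) log w`, smooth across the fold. The identity `dS = v·dx + Θ·d𝒜` makes `T`
canonical, and since `|𝒜|² = H`, it maps the Kepler vector field to the free motion `(a, 0)`.

To invert `T`, one recovers `w` from `(ϑ, a)` as the positive root of Kepler's equation
`w + 2 log w - c/w = 4|a|(ϑ·a)/q` with `c = 1 + 4|a|²L²/q²`. The left-hand side has positive
derivative in `w`, so the root is smooth. Along `ϑ + ta` the right-hand side is affine in `t` while
`c` is constant, hence `w → ∞` at most linearly. This gives `|X - ϑ - ta| = O(1 + log w) = o(t)` and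
`|V - a| = O(1/w)`.
-/

namespace RepulsiveKepler

open scoped RealInnerProductSpace

/-! ### Derivatives of norms, exact one-forms and the symplectic form -/

section

variable {E F : Type*} [NormedAddCommGroup E] [InnerProductSpace ℝ E]
  [NormedAddCommGroup F] [NormedSpace ℝ F]

lemma hasFDerivAt_norm {x : E} (hx : 0 < ‖x‖) :
    HasFDerivAt (fun y : E => ‖y‖) (‖x‖⁻¹ • innerSL ℝ x) x := by
  have h := (hasStrictFDerivAt_norm_sq x).hasFDerivAt.sqrt (by positivity)
  simp only [Real.sqrt_sq (norm_nonneg _)] at h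
  refine h.congr_fderiv ?_
  rw [two_nsmul, ← two_smul ℝ, smul_smul]
  congr 1
  field_simp

lemma inner_fderiv_of_norm_eventuallyEq {f : F → E} {g : F → ℝ} {u : F}
    (hf : DifferentiableAt ℝ f u) (hg : DifferentiableAt ℝ g u)
    (h : (fun y => ‖f y‖) =ᶠ[𝓝 u] g) (ξ : F) :
    ⟪f u, fderiv ℝ f u ξ⟫ = g u * fderiv ℝ g u ξ := by
  have hsq : (fun y => ‖f y‖ ^ 2) =ᶠ[𝓝 u] fun y => g y ^ 2 := h.pow_const 2
  have hderiv := congrArg (fun L => L ξ) <|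
    hf.hasFDerivAt.norm_sq.unique ((hg.hasFDerivAt.pow 2).congr_of_eventuallyEq hsq)
  simp only [ContinuousLinearMap.comp_apply, smul_apply, coe_innerSL_apply, nsmul_eq_mul,
    smul_eq_mul, Nat.cast_ofNat, Nat.add_one_sub_one, pow_one] at hderiv
  linarith

lemma eq_of_hasDerivWithinAt_zero {I : Set ℝ} (hI : I.OrdConnected) {f : ℝ → F}
    (hf : ∀ t ∈ I, HasDerivWithinAt f 0 I t) {s t : ℝ} (hs : s ∈ I) (ht : t ∈ I) :
    f t = f s := by
  have h := hI.convex.norm_image_sub_le_of_norm_hasDerivWithin_le (C := 0) hf (by simp) hs ht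
  rw [zero_mul] at h
  exact sub_eq_zero.1 (norm_le_zero_iff.1 h)

/-- The canonical symplectic form `∑ⱼ dpⱼ ∧ drⱼ` on `E × E`, written without coordinates. -/
def symplecticForm (ξ ζ : E × E) : ℝ := ⟪ξ.1, ζ.2⟫ - ⟪ξ.2, ζ.1⟫

lemma symplecticForm_sub_left (ξ ξ' ζ : E × E) :
    symplecticForm (ξ - ξ') ζ = symplecticForm ξ ζ - symplecticForm ξ' ζ := by
  simp only [symplecticForm, Prod.fst_sub, Prod.snd_sub, inner_sub_left]
  ring

lemma eq_of_symplecticForm_eq {ξ ξ' : E × E}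
    (h : ∀ ζ, symplecticForm ξ ζ = symplecticForm ξ' ζ) : ξ = ξ' := by
  have h' (ζ : E × E) : symplecticForm (ξ - ξ') ζ = 0 := by
    rw [symplecticForm_sub_left, h, sub_self]
  have hfst := h' (0, (ξ - ξ').1)
  have hsnd := h' ((ξ - ξ').2, 0)
  simp only [symplecticForm, inner_zero_right, sub_zero, zero_sub, neg_eq_zero,
    inner_self_eq_zero] at hfst hsnd
  exact sub_eq_zero.1 (Prod.ext hfst hsnd)

lemma injective_of_symplecticForm_map {D : E × E → E × E}
    (hD : ∀ ξ ζ, symplecticForm (D ξ) (D ζ) = symplecticForm ξ ζ) : Function.Injective D := by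
  intro ξ ξ' h
  refine eq_of_symplecticForm_eq fun ζ => ?_
  rw [← hD, h, hD]

lemma map_eq_of_symplecticForm_eq {D : E × E → E × E}
    (hD : ∀ ξ ζ, symplecticForm (D ξ) (D ζ) = symplecticForm ξ ζ) (hsurj : Function.Surjective D)
    {X Y : E × E} (h : ∀ ζ, symplecticForm X ζ = symplecticForm Y (D ζ)) : D X = Y := by
  refine eq_of_symplecticForm_eq fun η => ?_
  obtain ⟨ζ, rfl⟩ := hsurj η
  rw [hD, h]

lemma symplecticForm_fderiv_of_exact {s : E × E → ℝ} {P Q : E × E → E} {z : E × E}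
    (hs : ContDiffAt ℝ 2 s z) (hP : DifferentiableAt ℝ P z) (hQ : ContDiffAt ℝ 2 Q z)
    (h : ∀ᶠ y in 𝓝 z, ∀ ξ, fderiv ℝ s y ξ = ⟪y.2, ξ.1⟫ + ⟪P y, fderiv ℝ Q y ξ⟫)
    (ξ ζ : E × E) :
    symplecticForm (fderiv ℝ P z ξ, fderiv ℝ Q z ξ) (fderiv ℝ P z ζ, fderiv ℝ Q z ζ) =
      symplecticForm ξ ζ := by
  have hs' : DifferentiableAt ℝ (fderiv ℝ s) z :=
    (hs.fderiv_right (m := 1) (by norm_num)).differentiableAt one_ne_zero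
  have hQ' : DifferentiableAt ℝ (fderiv ℝ Q) z :=
    (hQ.fderiv_right (m := 1) (by norm_num)).differentiableAt one_ne_zero
  have second_derivative (ξ ζ : E × E) : fderiv ℝ (fderiv ℝ s) z ζ ξ =
      ⟪ζ.2, ξ.1⟫ + (⟪P z, fderiv ℝ (fderiv ℝ Q) z ζ ξ⟫ +
        ⟪fderiv ℝ P z ζ, fderiv ℝ Q z ξ⟫) := by
    have hleft := hs'.hasFDerivAt.clm_apply (hasFDerivAt_const ξ z)
    have hright := ((hasFDerivAt_snd (𝕜 := ℝ) (p := z)).inner ℝ (hasFDerivAt_const ξ.1 z)).add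
      (hP.hasFDerivAt.inner ℝ (hQ'.hasFDerivAt.clm_apply (hasFDerivAt_const ξ z)))
    have := congrArg (fun L => L ζ) <|
      hleft.unique (hright.congr_of_eventuallyEq (h.mono fun y hy => hy ξ))
    simpa using this
  have hsymm_s : IsSymmSndFDerivAt ℝ s z := hs.isSymmSndFDerivAt (by simp)
  have hsymm_Q : IsSymmSndFDerivAt ℝ Q z := hQ.isSymmSndFDerivAt (by simp)
  have hξζ := second_derivative ξ ζ
  rw [hsymm_s ζ ξ, hsymm_Q ζ ξ, second_derivative ζ ξ] at hξζ
  simp only [symplecticForm, real_inner_comm (fderiv ℝ P z ζ), real_inner_comm ζ.2]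
  linarith

end

/-! ### Kepler's equation -/

/-- The left-hand side of Kepler's equation in the variable `w = √c exp η`: the equation
`keplerFun c w = 2 M + log c` is the hyperbolic Kepler equation `e sinh η + η = M` for the
eccentricity `e = √c`. -/
noncomputable def keplerFun (c w : ℝ) : ℝ := w + 2 * Real.log w - c / w

lemma strictMonoOn_keplerFun {c : ℝ} (hc : 0 ≤ c) : StrictMonoOn (keplerFun c) (Ioi 0) := by
  intro w hw w' _ h
  have hlog := Real.log_lt_log hw h
  have hdiv := div_le_div_of_nonneg_left hc hw h.le
  simp only [keplerFun]
  linarith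

lemma surjOn_keplerFun {c : ℝ} (hc : 0 ≤ c) : SurjOn (keplerFun c) (Ioi 0) univ := by
  have hcont : Continuous fun η : ℝ => keplerFun c (Real.exp η) := by
    simp only [keplerFun, Real.log_exp]
    fun_prop (disch := exact fun _ => (Real.exp_pos _).ne')
  have htop : Tendsto (fun η : ℝ => keplerFun c (Real.exp η)) atTop atTop := by
    refine tendsto_atTop_mono' atTop ?_ (tendsto_atTop_add_const_right _ (-c) tendsto_id)
    filter_upwards [eventually_ge_atTop 0] with η hη
    have hone := Real.one_le_exp hη
    have hdiv := div_le_self hc hone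
    simp only [keplerFun, Real.log_exp, id]
    linarith [Real.exp_pos η]
  have hbot : Tendsto (fun η : ℝ => keplerFun c (Real.exp η)) atBot atBot := by
    refine tendsto_atBot_mono' atBot ?_ (tendsto_atBot_add_const_right _ 1 tendsto_id)
    filter_upwards [eventually_le_atBot 0] with η hη
    have hone := Real.exp_le_one_iff.2 hη
    have hdiv : 0 ≤ c / Real.exp η := by positivity
    simp only [keplerFun, Real.log_exp, id]
    linarith
  intro σ _
  obtain ⟨η, hη⟩ := hcont.surjective htop hbot σ
  exact ⟨Real.exp η, Real.exp_pos η, hη⟩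

/-- The positive solution `w` of Kepler's equation `keplerFun c w = σ`, for `0 ≤ c`. -/
noncomputable def keplerRoot (c σ : ℝ) : ℝ := Function.invFunOn (keplerFun c) (Ioi 0) σ

lemma keplerRoot_pos {c : ℝ} (hc : 0 ≤ c) (σ : ℝ) : 0 < keplerRoot c σ :=
  Function.invFunOn_mem (surjOn_keplerFun hc (mem_univ σ))

lemma keplerFun_keplerRoot {c : ℝ} (hc : 0 ≤ c) (σ : ℝ) : keplerFun c (keplerRoot c σ) = σ :=
  Function.invFunOn_eq (surjOn_keplerFun hc (mem_univ σ))

lemma keplerRoot_keplerFun {c w : ℝ} (hc : 0 ≤ c) (hw : 0 < w) :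
    keplerRoot c (keplerFun c w) = w :=
  (strictMonoOn_keplerFun hc).injOn (keplerRoot_pos hc _) hw (keplerFun_keplerRoot hc _)

lemma hasDerivAt_keplerFun (c : ℝ) {w : ℝ} (hw : 0 < w) :
    HasDerivAt (keplerFun c) (1 + 2 / w + c / w ^ 2) w := by
  have h := ((hasDerivAt_id w).add ((Real.hasDerivAt_log hw.ne').const_mul 2)).sub
    ((hasDerivAt_inv hw.ne').const_mul c)
  refine (h.congr_deriv ?_).congr_of_eventuallyEq (Eventually.of_forall fun y => ?_)
  · field_simp
    ring
  · simp [keplerFun, div_eq_mul_inv]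

lemma contDiffAt_keplerRoot {p : ℝ × ℝ} (hp : 0 < p.1) :
    ContDiffAt ℝ ∞ (fun p : ℝ × ℝ => keplerRoot p.1 p.2) p := by
  let f : (ℝ × ℝ) × ℝ → ℝ := fun u => keplerFun u.1.1 u.2 - u.1.2
  let w := keplerRoot p.1 p.2
  have hw : 0 < w := keplerRoot_pos hp.le _
  have hf : ContDiffAt ℝ ∞ f (p, w) := by
    simp only [f, keplerFun]
    fun_prop (disch := exact hw.ne')
  have hderiv : fderiv ℝ f (p, w) ∘L .inr ℝ (ℝ × ℝ) ℝ =
      .toSpanSingleton ℝ (1 + 2 / w + p.1 / w ^ 2) := by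
    have hslice : HasFDerivAt (fun y => f (p, y)) (fderiv ℝ f (p, w) ∘L .inr ℝ (ℝ × ℝ) ℝ) w :=
      (hf.differentiableAt (by simp)).hasFDerivAt.comp w (hasFDerivAt_prodMk_right p w)
    exact hslice.unique ((hasDerivAt_keplerFun p.1 hw).sub_const p.2).hasFDerivAt
  have hinv : (fderiv ℝ f (p, w) ∘L .inr ℝ (ℝ × ℝ) ℝ).IsInvertible := by
    rw [hderiv]
    have hne : 1 + 2 / w + p.1 / w ^ 2 ≠ 0 := by positivity
    exact ⟨ContinuousLinearEquiv.unitsEquivAut ℝ (Units.mk0 _ hne), by ext; simp⟩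
  refine (hf.contDiffAt_implicitFunction (by simp) hinv).congr_of_eventuallyEq ?_
  have htendsto : Tendsto (hf.implicitFunction (by simp) hinv) (𝓝 p) (𝓝 w) := by
    have := (hf.contDiffAt_implicitFunction (by simp) hinv).continuousAt.tendsto
    rwa [hf.implicitFunction_apply_self (by simp) hinv] at this
  filter_upwards [hf.eventually_apply_implicitFunction (by simp) hinv,
    htendsto.eventually_const_lt hw,
    continuousAt_fst.eventually_const_lt hp] with p' hroot hpos hp'
  have hroot' : keplerFun p'.1 (hf.implicitFunction (by simp) hinv p') = p'.2 := by
    simpa only [f, w, keplerFun_keplerRoot hp.le, sub_self, sub_eq_zero] using hroot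
  rw [← keplerRoot_keplerFun hp'.le hpos, hroot']

lemma keplerRoot_le {c σ : ℝ} (hc : 0 ≤ c) (hw : 1 ≤ keplerRoot c σ) : keplerRoot c σ ≤ σ + c := by
  have hlog := Real.log_nonneg hw
  have hdiv := div_le_self hc hw
  have := keplerFun_keplerRoot hc σ
  rw [keplerFun] at this
  linarith

lemma tendsto_keplerRoot_atTop {c : ℝ} (hc : 0 ≤ c) : Tendsto (keplerRoot c) atTop atTop := by
  refine tendsto_atTop.2 fun b => ?_
  filter_upwards [eventually_ge_atTop (keplerFun c (max b 1))] with σ hσ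
  rw [← keplerFun_keplerRoot hc σ] at hσ
  exact (le_max_left b 1).trans <|
    ((strictMonoOn_keplerFun hc).le_iff_le (by simp) (keplerRoot_pos hc σ)).1 hσ

lemma isBigO_keplerRoot {c : ℝ} (hc : 0 ≤ c) : keplerRoot c =O[atTop] (id : ℝ → ℝ) := by
  refine IsBigO.of_bound 2 ?_
  filter_upwards [eventually_ge_atTop c,
    (tendsto_keplerRoot_atTop hc).eventually_ge_atTop 1] with σ hσ hw
  rw [Real.norm_of_nonneg (by linarith), id, Real.norm_of_nonneg (hc.trans hσ)]
  linarith [keplerRoot_le hc hw]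

lemma isLittleO_log_keplerRoot {c : ℝ} (hc : 0 ≤ c) :
    (fun σ => Real.log (keplerRoot c σ)) =o[atTop] (id : ℝ → ℝ) :=
  (Real.isLittleO_log_id_atTop.comp_tendsto (tendsto_keplerRoot_atTop hc)).trans_isBigO
    (isBigO_keplerRoot hc)

/-! ### The action-angle map -/

section

variable {E : Type*} [NormedAddCommGroup E] {q : ℝ} {z : E × E}

lemma eventually_norm_fst_pos (hz : 0 < ‖z.1‖) : ∀ᶠ z' : E × E in 𝓝 z, 0 < ‖z'.1‖ :=
  continuous_fst.norm.continuousAt.eventually_const_lt hz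

/-- The asymptotic speed `√H` of the orbit through `z = (x, v)`. -/
noncomputable def speed (q : ℝ) (z : E × E) : ℝ := √(‖z.2‖ ^ 2 + q / ‖z.1‖)

lemma speed_pos (hq : 0 < q) (hz : 0 < ‖z.1‖) : 0 < speed q z :=
  Real.sqrt_pos.2 (by positivity)

lemma speed_sq (hq : 0 < q) (hz : 0 < ‖z.1‖) : speed q z ^ 2 = ‖z.2‖ ^ 2 + q / ‖z.1‖ :=
  Real.sq_sqrt (by positivity)

lemma norm_snd_lt_speed (hq : 0 < q) (hz : 0 < ‖z.1‖) : ‖z.2‖ < speed q z :=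
  Real.lt_sqrt_of_sq_lt (lt_add_of_pos_right _ (by positivity))

variable [InnerProductSpace ℝ E]

/-- The Gram determinant of two vectors, which is the squared angular momentum `|x × v|²` when `E`
is Euclidean three-space. -/
def gramDet (x y : E) : ℝ := ‖x‖ ^ 2 * ‖y‖ ^ 2 - ⟪x, y⟫ ^ 2

lemma gramDet_nonneg (x y : E) : 0 ≤ gramDet x y := by
  have := real_inner_mul_inner_self_le x y
  rw [real_inner_self_eq_norm_sq, real_inner_self_eq_norm_sq, ← sq] at this
  exact sub_nonneg.2 this

lemma gramDet_comm (x y : E) : gramDet x y = gramDet y x := by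
  rw [gramDet, gramDet, real_inner_comm, mul_comm]

lemma gramDet_smul_add_smul_left (x y : E) (c d : ℝ) :
    gramDet (c • x + d • y) y = c ^ 2 * gramDet x y := by
  simp only [gramDet, ← real_inner_self_eq_norm_sq, inner_add_left, inner_add_right,
    inner_smul_left, inner_smul_right, real_inner_comm x y, RCLike.conj_to_real]
  ring

lemma gramDet_add_smul_left (x y : E) (d : ℝ) : gramDet (x + d • y) y = gramDet x y := by
  simpa using gramDet_smul_add_smul_left x y 1 d

/-- A parameter along the orbit through `z = (x, v)`, increasing from `0` to `∞` and equal to `1` on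
the fold. -/
noncomputable def orbitParam (q : ℝ) (z : E × E) : ℝ :=
  2 * speed q z / q * (⟪z.1, z.2⟫ + speed q z * ‖z.1‖) - 1

/-- The vector of length `√H` in the direction of the position. -/
noncomputable def radial (q : ℝ) (z : E × E) : E := (speed q z / ‖z.1‖) • z.1

/-- The action `𝒜(x, v)`, which is the asymptotic velocity of the orbit through `z = (x, v)`. -/
noncomputable def action (q : ℝ) (z : E × E) : E :=
  (orbitParam q z)⁻¹ • ((orbitParam q z + 1) • z.2 + radial q z)

/-- The coefficient of the action `𝒜` in the decomposition of the angle along `x` and `𝒜`, in terms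
of the asymptotic speed `α`, the orbit parameter `w` and the distance `r` to the origin. -/
noncomputable def drift (q α w r : ℝ) : ℝ :=
  q * Real.log w / (2 * α ^ 3) - r / (α * (w + 1))

/-- The angle `Θ(x, v)`. -/
noncomputable def angle (q : ℝ) (z : E × E) : E :=
  (orbitParam q z / (orbitParam q z + 1)) • z.1 +
    drift q (speed q z) (orbitParam q z) ‖z.1‖ • action q z

/-- The map `(x, v) ↦ (Θ, 𝒜)`. -/
noncomputable def actionAngle (q : ℝ) (z : E × E) : E × E := (angle q z, action q z)

lemma mul_orbitParam_add_one (hq : 0 < q) :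
    q * (orbitParam q z + 1) = 2 * speed q z * (⟪z.1, z.2⟫ + speed q z * ‖z.1‖) := by
  rw [orbitParam]
  field_simp
  ring

lemma orbitParam_pos (hq : 0 < q) (hz : 0 < ‖z.1‖) : 0 < orbitParam q z := by
  have hspeed : q = (speed q z ^ 2 - ‖z.2‖ ^ 2) * ‖z.1‖ := by
    rw [speed_sq hq hz]
    field_simp
    ring
  have hinner : -(‖z.1‖ * ‖z.2‖) ≤ ⟪z.1, z.2⟫ := neg_le_of_abs_le (abs_real_inner_le_norm _ _)
  have hsq : 0 < ‖z.1‖ * (speed q z - ‖z.2‖) ^ 2 :=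
    mul_pos hz (pow_pos (sub_pos.2 (norm_snd_lt_speed hq hz)) 2)
  refine pos_of_mul_pos_right (a := q) ?_ hq.le
  calc 0 < ‖z.1‖ * (speed q z - ‖z.2‖) ^ 2 := hsq
    _ = 2 * speed q z * (-(‖z.1‖ * ‖z.2‖) + speed q z * ‖z.1‖) -
        (speed q z ^ 2 - ‖z.2‖ ^ 2) * ‖z.1‖ := by ring
    _ ≤ 2 * speed q z * (⟪z.1, z.2⟫ + speed q z * ‖z.1‖) - q := by
        rw [← hspeed]
        have hα := speed_pos hq hz
        gcongr
    _ = q * orbitParam q z := by rw [← mul_orbitParam_add_one hq]; ring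

lemma inner_fst_snd (hq : 0 < q) (hz : 0 < ‖z.1‖) :
    ⟪z.1, z.2⟫ = q * (orbitParam q z + 1) / (2 * speed q z) - speed q z * ‖z.1‖ := by
  have hα := speed_pos hq hz
  rw [mul_orbitParam_add_one hq]
  field_simp
  ring

lemma gramDet_fst_snd (hq : 0 < q) (hz : 0 < ‖z.1‖) :
    gramDet z.1 z.2 =
      q * orbitParam q z * ‖z.1‖ - q ^ 2 * (orbitParam q z + 1) ^ 2 / (4 * speed q z ^ 2) := by
  have hα := speed_pos hq hz
  rw [gramDet, inner_fst_snd hq hz, ← sub_eq_iff_eq_add.2 (speed_sq hq hz)]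
  field_simp
  ring

lemma orbitParam_smul_action (hq : 0 < q) (hz : 0 < ‖z.1‖) :
    orbitParam q z • action q z = (orbitParam q z + 1) • z.2 + radial q z :=
  smul_inv_smul₀ (orbitParam_pos hq hz).ne' _

lemma inner_fst_radial (hz : 0 < ‖z.1‖) : ⟪z.1, radial q z⟫ = speed q z * ‖z.1‖ := by
  rw [radial, inner_smul_right, real_inner_self_eq_norm_sq]
  field_simp

lemma norm_radial (hq : 0 < q) (hz : 0 < ‖z.1‖) : ‖radial q z‖ = speed q z := by
  have hα := speed_pos hq hz
  rw [radial, norm_smul, Real.norm_of_nonneg (by positivity), div_mul_cancel₀ _ hz.ne']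

lemma inner_fst_action (hq : 0 < q) (hz : 0 < ‖z.1‖) :
    ⟪z.1, action q z⟫ =
      q * (orbitParam q z + 1) ^ 2 / (2 * speed q z * orbitParam q z) - speed q z * ‖z.1‖ := by
  have hα := speed_pos hq hz
  have hw := orbitParam_pos hq hz
  rw [action, inner_smul_right, inner_add_right, inner_smul_right, inner_fst_radial hz,
    inner_fst_snd hq hz]
  field_simp
  ring

lemma norm_action (hq : 0 < q) (hz : 0 < ‖z.1‖) : ‖action q z‖ = speed q z := by
  have hα := speed_pos hq hz
  have hw := orbitParam_pos hq hz
  have hinner : ⟪z.2, radial q z⟫ = speed q z / ‖z.1‖ * ⟪z.1, z.2⟫ := by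
    rw [radial, inner_smul_right, real_inner_comm]
  have hsq : (orbitParam q z * ‖action q z‖) ^ 2 = (orbitParam q z * speed q z) ^ 2 := by
    rw [← Real.norm_of_nonneg hw.le, ← norm_smul, orbitParam_smul_action hq hz, norm_add_sq_real,
      norm_smul, mul_pow, real_inner_smul_left, hinner, inner_fst_snd hq hz, norm_radial hq hz,
      ← sub_eq_iff_eq_add.2 (speed_sq hq hz), Real.norm_eq_abs, Real.norm_eq_abs, abs_of_pos hw,
      abs_of_pos (by positivity)]
    field_simp
    ring
  exact mul_left_cancel₀ hw.ne' <| (sq_eq_sq₀ (by positivity) (by positivity)).1 hsq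

lemma apply_angle_action {F : Type*} [AddCommGroup F] [Module ℝ F] {B : E →ₗ[ℝ] E →ₗ[ℝ] F}
    (hB : B.IsAlt) (hq : 0 < q) (hz : 0 < ‖z.1‖) :
    B (angle q z) (action q z) = B z.1 z.2 := by
  have hw := orbitParam_pos hq hz
  have hangle : B (angle q z) (action q z) =
      (orbitParam q z / (orbitParam q z + 1)) • B z.1 (action q z) := by
    simp only [angle, map_add, map_smul, LinearMap.add_apply, LinearMap.smul_apply, hB.self_eq_zero,
      smul_zero, add_zero]
  have haction : B z.1 (action q z) = ((orbitParam q z + 1) / orbitParam q z) • B z.1 z.2 := by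
    simp only [action, radial, map_add, map_smul, hB.self_eq_zero, smul_zero, add_zero, smul_smul]
    rw [div_eq_inv_mul]
  rw [hangle, haction, smul_smul, div_mul_div_cancel₀ (by positivity), div_self hw.ne', one_smul]

lemma gramDet_angle_action (hq : 0 < q) (hz : 0 < ‖z.1‖) :
    gramDet (angle q z) (action q z) = gramDet z.1 z.2 := by
  have hw := orbitParam_pos hq hz
  rw [angle, gramDet_smul_add_smul_left, gramDet_comm, action, radial, smul_add, smul_smul,
    smul_smul, gramDet_smul_add_smul_left, gramDet_comm]
  field_simp

end

/-! ### Inversion of the action-angle map by means of Kepler's equation -/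

section

variable {E : Type*} [NormedAddCommGroup E] [InnerProductSpace ℝ E] {q : ℝ} {y z : E × E}

/-- The squared eccentricity of the orbit with angle and action `y = (ϑ, a)`. -/
noncomputable def eccentricitySq (q : ℝ) (y : E × E) : ℝ :=
  1 + 4 * ‖y.2‖ ^ 2 * gramDet y.1 y.2 / q ^ 2

/-- The right-hand side of Kepler's equation for the orbit with angle and action `y = (ϑ, a)`; along
an orbit it is an affine function of time. -/
noncomputable def orbitPhase (q : ℝ) (y : E × E) : ℝ := 4 * ‖y.2‖ * ⟪y.1, y.2⟫ / q

/-- The orbit parameter as a function of the angle and action `y = (ϑ, a)`. -/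
noncomputable def rootParam (q : ℝ) (y : E × E) : ℝ :=
  keplerRoot (eccentricitySq q y) (orbitPhase q y)

/-- The distance to the origin as a function of the angle and action `y = (ϑ, a)`. -/
noncomputable def radius (q : ℝ) (y : E × E) : ℝ :=
  q / (4 * ‖y.2‖ ^ 2) * (rootParam q y + 2 + eccentricitySq q y / rootParam q y)

/-- The position `X(ϑ, a)`. -/
noncomputable def position (q : ℝ) (y : E × E) : E :=
  ((rootParam q y + 1) / rootParam q y) •
    (y.1 - drift q ‖y.2‖ (rootParam q y) (radius q y) • y.2)

/-- The velocity `V(ϑ, a)`. -/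
noncomputable def velocity (q : ℝ) (y : E × E) : E :=
  (rootParam q y + 1)⁻¹ • (rootParam q y • y.2 - (‖y.2‖ / radius q y) • position q y)

/-- The map `(ϑ, a) ↦ (X, V)`. -/
noncomputable def ofActionAngle (q : ℝ) (y : E × E) : E × E := (position q y, velocity q y)

lemma one_le_eccentricitySq (q : ℝ) (y : E × E) : 1 ≤ eccentricitySq q y := by
  have := gramDet_nonneg y.1 y.2
  exact le_add_of_nonneg_right (by positivity)

lemma eccentricitySq_pos (q : ℝ) (y : E × E) : 0 < eccentricitySq q y :=
  one_pos.trans_le (one_le_eccentricitySq q y)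

lemma eccentricitySq_actionAngle (hq : 0 < q) (hz : 0 < ‖z.1‖) :
    eccentricitySq q (actionAngle q z) =
      4 * speed q z ^ 2 * orbitParam q z * ‖z.1‖ / q
        - orbitParam q z * (orbitParam q z + 2) := by
  have hα := speed_pos hq hz
  simp only [eccentricitySq, actionAngle, norm_action hq hz, gramDet_angle_action hq hz,
    gramDet_fst_snd hq hz]
  field_simp
  ring

lemma keplerFun_orbitParam (hq : 0 < q) (hz : 0 < ‖z.1‖) :
    keplerFun (eccentricitySq q (actionAngle q z)) (orbitParam q z) =
      orbitPhase q (actionAngle q z) := by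
  have hα := speed_pos hq hz
  have hw := orbitParam_pos hq hz
  have hinner : ⟪angle q z, action q z⟫ = orbitParam q z / (orbitParam q z + 1) *
      (q * (orbitParam q z + 1) ^ 2 / (2 * speed q z * orbitParam q z) - speed q z * ‖z.1‖) +
        drift q (speed q z) (orbitParam q z) ‖z.1‖ * speed q z ^ 2 := by
    rw [angle, inner_add_left, real_inner_smul_left, real_inner_smul_left, inner_fst_action hq hz,
      real_inner_self_eq_norm_sq, norm_action hq hz]
  rw [eccentricitySq_actionAngle hq hz, keplerFun, orbitPhase]
  simp only [actionAngle, norm_action hq hz, hinner, drift]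
  field_simp
  ring

lemma rootParam_actionAngle (hq : 0 < q) (hz : 0 < ‖z.1‖) :
    rootParam q (actionAngle q z) = orbitParam q z := by
  rw [rootParam, ← keplerFun_orbitParam hq hz,
    keplerRoot_keplerFun (eccentricitySq_pos _ _).le (orbitParam_pos hq hz)]

lemma radius_actionAngle (hq : 0 < q) (hz : 0 < ‖z.1‖) :
    radius q (actionAngle q z) = ‖z.1‖ := by
  have hα := speed_pos hq hz
  have hw := orbitParam_pos hq hz
  rw [radius, rootParam_actionAngle hq hz, eccentricitySq_actionAngle hq hz, actionAngle,
    norm_action hq hz]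
  field_simp
  ring

lemma position_actionAngle (hq : 0 < q) (hz : 0 < ‖z.1‖) :
    position q (actionAngle q z) = z.1 := by
  have hw := orbitParam_pos hq hz
  rw [position, rootParam_actionAngle hq hz, radius_actionAngle hq hz]
  simp only [actionAngle, norm_action hq hz, angle, add_sub_cancel_right]
  rw [smul_smul, div_mul_div_cancel₀ hw.ne', div_self (by positivity), one_smul]

lemma velocity_actionAngle (hq : 0 < q) (hz : 0 < ‖z.1‖) :
    velocity q (actionAngle q z) = z.2 := by
  have hw := orbitParam_pos hq hz
  rw [velocity, rootParam_actionAngle hq hz, radius_actionAngle hq hz, position_actionAngle hq hz]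
  simp only [actionAngle, norm_action hq hz, orbitParam_smul_action hq hz]
  rw [← radial, add_sub_cancel_right, inv_smul_smul₀ (by positivity)]

lemma ofActionAngle_actionAngle (hq : 0 < q) (hz : 0 < ‖z.1‖) :
    ofActionAngle q (actionAngle q z) = z :=
  Prod.ext (position_actionAngle hq hz) (velocity_actionAngle hq hz)

lemma rootParam_pos (q : ℝ) (y : E × E) : 0 < rootParam q y :=
  keplerRoot_pos (eccentricitySq_pos q y).le _

lemma radius_pos (hq : 0 < q) (hy : 0 < ‖y.2‖) : 0 < radius q y := by
  have hw := rootParam_pos q y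
  have hc := eccentricitySq_pos q y
  rw [radius]
  positivity

lemma gramDet_eq_radius (hq : 0 < q) (hy : 0 < ‖y.2‖) :
    gramDet y.1 y.2 =
      q * rootParam q y * radius q y - q ^ 2 * (rootParam q y + 1) ^ 2 / (4 * ‖y.2‖ ^ 2) := by
  have hw := rootParam_pos q y
  rw [radius, eccentricitySq]
  field_simp
  ring

lemma inner_eq_radius (hq : 0 < q) (hy : 0 < ‖y.2‖) :
    ⟪y.1, y.2⟫ = q * (rootParam q y + 1) / (2 * ‖y.2‖) - rootParam q y / (rootParam q y + 1) *
      (‖y.2‖ * radius q y) + drift q ‖y.2‖ (rootParam q y) (radius q y) * ‖y.2‖ ^ 2 := by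
  have hw := rootParam_pos q y
  have hphase := keplerFun_keplerRoot (eccentricitySq_pos q y).le (orbitPhase q y)
  have hecc : eccentricitySq q y = 4 * ‖y.2‖ ^ 2 * rootParam q y * radius q y / q -
      rootParam q y * (rootParam q y + 2) := by
    rw [radius]
    field_simp
    ring
  rw [← rootParam, keplerFun, hecc, orbitPhase, eq_div_iff hq.ne'] at hphase
  refine mul_left_cancel₀ (mul_pos four_pos hy).ne' ?_
  rw [← hphase, drift]
  field_simp
  ring

lemma inner_position_snd (hq : 0 < q) (hy : 0 < ‖y.2‖) :
    ⟪position q y, y.2⟫ =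
      q * (rootParam q y + 1) ^ 2 / (2 * ‖y.2‖ * rootParam q y) - ‖y.2‖ * radius q y := by
  have hw := rootParam_pos q y
  rw [position, real_inner_smul_left, inner_sub_left, real_inner_smul_left,
    real_inner_self_eq_norm_sq, inner_eq_radius hq hy]
  field_simp
  ring

lemma norm_position (hq : 0 < q) (hy : 0 < ‖y.2‖) : ‖position q y‖ = radius q y := by
  have hw := rootParam_pos q y
  have hr := radius_pos hq hy
  have hgram : gramDet (position q y) y.2 =
      ((rootParam q y + 1) / rootParam q y) ^ 2 * gramDet y.1 y.2 := by
    rw [position, smul_sub, smul_smul, sub_eq_add_neg, ← neg_smul, gramDet_smul_add_smul_left]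
  rw [gramDet, inner_position_snd hq hy, gramDet_eq_radius hq hy, sub_eq_iff_eq_add] at hgram
  have hsq : ‖position q y‖ ^ 2 * ‖y.2‖ ^ 2 = radius q y ^ 2 * ‖y.2‖ ^ 2 := by
    rw [hgram]
    field_simp
    ring
  exact (sq_eq_sq₀ (norm_nonneg _) hr.le).1 (mul_right_cancel₀ (by positivity) hsq)

lemma inner_position_velocity (hq : 0 < q) (hy : 0 < ‖y.2‖) :
    ⟪position q y, velocity q y⟫ =
      q * (rootParam q y + 1) / (2 * ‖y.2‖) - ‖y.2‖ * radius q y := by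
  have hw := rootParam_pos q y
  rw [velocity, inner_smul_right, inner_sub_right, inner_smul_right, inner_smul_right,
    real_inner_self_eq_norm_sq, norm_position hq hy, inner_position_snd hq hy]
  field_simp
  ring

lemma norm_velocity_sq (hq : 0 < q) (hy : 0 < ‖y.2‖) :
    ‖velocity q y‖ ^ 2 = ‖y.2‖ ^ 2 - q / radius q y := by
  have hw := rootParam_pos q y
  have hr := radius_pos hq hy
  rw [velocity, norm_smul, mul_pow, norm_sub_sq_real, norm_smul, norm_smul, real_inner_smul_left,
    real_inner_smul_right, real_inner_comm, norm_position hq hy, inner_position_snd hq hy,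
    Real.norm_of_nonneg (by positivity), Real.norm_of_nonneg (by positivity),
    Real.norm_of_nonneg (by positivity)]
  field_simp
  ring

lemma speed_ofActionAngle (hq : 0 < q) (hy : 0 < ‖y.2‖) : speed q (ofActionAngle q y) = ‖y.2‖ := by
  rw [speed, ofActionAngle, norm_velocity_sq hq hy, norm_position hq hy, sub_add_cancel,
    Real.sqrt_sq hy.le]

lemma orbitParam_ofActionAngle (hq : 0 < q) (hy : 0 < ‖y.2‖) :
    orbitParam q (ofActionAngle q y) = rootParam q y := by
  rw [orbitParam, speed_ofActionAngle hq hy, ofActionAngle, inner_position_velocity hq hy,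
    norm_position hq hy]
  field_simp
  ring

lemma action_ofActionAngle (hq : 0 < q) (hy : 0 < ‖y.2‖) :
    action q (ofActionAngle q y) = y.2 := by
  have hw := rootParam_pos q y
  rw [action, radial, orbitParam_ofActionAngle hq hy, speed_ofActionAngle hq hy, ofActionAngle,
    norm_position hq hy, velocity, smul_inv_smul₀ (by positivity), sub_add_cancel,
    inv_smul_smul₀ hw.ne']

lemma angle_ofActionAngle (hq : 0 < q) (hy : 0 < ‖y.2‖) :
    angle q (ofActionAngle q y) = y.1 := by
  have hw := rootParam_pos q y
  rw [angle, action_ofActionAngle hq hy, orbitParam_ofActionAngle hq hy, speed_ofActionAngle hq hy,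
    ofActionAngle, norm_position hq hy, position, smul_smul, div_mul_div_cancel₀ (by positivity),
    div_self hw.ne', one_smul, sub_add_cancel]

lemma actionAngle_ofActionAngle (hq : 0 < q) (hy : 0 < ‖y.2‖) :
    actionAngle q (ofActionAngle q y) = y :=
  Prod.ext (angle_ofActionAngle hq hy) (action_ofActionAngle hq hy)

lemma norm_fst_ofActionAngle_pos (hq : 0 < q) (hy : 0 < ‖y.2‖) : 0 < ‖(ofActionAngle q y).1‖ := by
  rw [ofActionAngle, norm_position hq hy]
  exact radius_pos hq hy

lemma norm_snd_actionAngle_pos (hq : 0 < q) (hz : 0 < ‖z.1‖) : 0 < ‖(actionAngle q z).2‖ := by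
  rw [actionAngle, norm_action hq hz]
  exact speed_pos hq hz

/-- The map `T : (x, v) ↦ (Θ, 𝒜)`, together with its inverse. -/
noncomputable def actionAngleEquiv (E : Type*) [NormedAddCommGroup E] [InnerProductSpace ℝ E]
    (hq : 0 < q) : PartialEquiv (E × E) (E × E) where
  toFun := actionAngle q
  invFun := ofActionAngle q
  source := {z | 0 < ‖z.1‖}
  target := {y | 0 < ‖y.2‖}
  map_source' _ := norm_snd_actionAngle_pos hq
  map_target' _ := norm_fst_ofActionAngle_pos hq
  left_inv' _ := ofActionAngle_actionAngle hq
  right_inv' _ := actionAngle_ofActionAngle hq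

end

/-! ### Smoothness -/

section

variable {E : Type*} [NormedAddCommGroup E] [InnerProductSpace ℝ E] {q : ℝ} {y z : E × E}

lemma contDiffAt_speed (hq : 0 < q) (hz : 0 < ‖z.1‖) : ContDiffAt ℝ ∞ (speed q) z := by
  have henergy := Real.sqrt_pos.1 (speed_pos hq hz)
  exact ((contDiffAt_snd.norm_sq ℝ).add (contDiffAt_const.div
    (contDiffAt_fst.norm ℝ (norm_pos_iff.1 hz)) hz.ne')).sqrt henergy.ne'

lemma contDiffAt_orbitParam (hq : 0 < q) (hz : 0 < ‖z.1‖) : ContDiffAt ℝ ∞ (orbitParam q) z := by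
  have hspeed := contDiffAt_speed hq hz
  have hnorm := contDiffAt_fst.norm (x := z) (n := ∞) ℝ (norm_pos_iff.1 hz)
  exact (((contDiffAt_const.mul hspeed).div_const q).mul
    ((contDiffAt_fst.inner ℝ contDiffAt_snd).add (hspeed.mul hnorm))).sub contDiffAt_const

lemma contDiffAt_radial (hq : 0 < q) (hz : 0 < ‖z.1‖) : ContDiffAt ℝ ∞ (radial q) z :=
  ((contDiffAt_speed hq hz).div (contDiffAt_fst.norm ℝ (norm_pos_iff.1 hz)) hz.ne').smul
    contDiffAt_fst

lemma contDiffAt_action (hq : 0 < q) (hz : 0 < ‖z.1‖) : ContDiffAt ℝ ∞ (action q) z := by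
  have hparam := contDiffAt_orbitParam hq hz
  exact (hparam.inv (orbitParam_pos hq hz).ne').smul
    (((hparam.add contDiffAt_const).smul contDiffAt_snd).add (contDiffAt_radial hq hz))

lemma contDiffAt_drift {F : Type*} [NormedAddCommGroup F] [NormedSpace ℝ F] {α w r : F → ℝ}
    {n : ℕ∞ω} {u : F} (hα : ContDiffAt ℝ n α u) (hw : ContDiffAt ℝ n w u)
    (hr : ContDiffAt ℝ n r u) (hα0 : 0 < α u) (hw0 : 0 < w u) :
    ContDiffAt ℝ n (fun u => drift q (α u) (w u) (r u)) u :=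
  ((contDiffAt_const.mul (hw.log hw0.ne')).div (contDiffAt_const.mul (hα.pow 3))
    (by positivity)).sub (hr.div (hα.mul (hw.add contDiffAt_const)) (by positivity))

lemma contDiffAt_angle (hq : 0 < q) (hz : 0 < ‖z.1‖) : ContDiffAt ℝ ∞ (angle q) z := by
  have hw := orbitParam_pos hq hz
  have hparam := contDiffAt_orbitParam hq hz
  have hdrift := contDiffAt_drift (q := q) (contDiffAt_speed hq hz) hparam
    (contDiffAt_fst.norm ℝ (norm_pos_iff.1 hz)) (speed_pos hq hz) hw
  exact ((hparam.div (hparam.add contDiffAt_const) (by positivity)).smul contDiffAt_fst).add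
    (hdrift.smul (contDiffAt_action hq hz))

lemma contDiffAt_actionAngle (hq : 0 < q) (hz : 0 < ‖z.1‖) : ContDiffAt ℝ ∞ (actionAngle q) z :=
  (contDiffAt_angle hq hz).prodMk (contDiffAt_action hq hz)

lemma contDiffAt_norm_snd (hy : 0 < ‖y.2‖) : ContDiffAt ℝ ∞ (fun y : E × E => ‖y.2‖) y :=
  contDiffAt_snd.norm ℝ (norm_pos_iff.1 hy)

lemma contDiff_eccentricitySq : ContDiff ℝ ∞ (eccentricitySq (E := E) q) := by
  have hnorm : ContDiff ℝ ∞ fun y : E × E => ‖y.2‖ ^ 2 := contDiff_snd.norm_sq ℝ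
  exact contDiff_const.add (((contDiff_const.mul hnorm).mul
    (((contDiff_fst.norm_sq ℝ).mul hnorm).sub
      ((contDiff_fst.inner ℝ contDiff_snd).pow 2))).div_const _)

lemma contDiffAt_orbitPhase (hy : 0 < ‖y.2‖) : ContDiffAt ℝ ∞ (orbitPhase q) y :=
  ((contDiffAt_const.mul (contDiffAt_norm_snd hy)).mul
    (contDiffAt_fst.inner ℝ contDiffAt_snd)).div_const q

lemma contDiffAt_rootParam (hy : 0 < ‖y.2‖) : ContDiffAt ℝ ∞ (rootParam q) y :=
  ContDiffAt.comp (f := fun y => (eccentricitySq q y, orbitPhase q y)) y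
    (contDiffAt_keplerRoot (eccentricitySq_pos q y))
    (contDiff_eccentricitySq.contDiffAt.prodMk (contDiffAt_orbitPhase hy))

lemma contDiffAt_radius (hy : 0 < ‖y.2‖) : ContDiffAt ℝ ∞ (radius q) y := by
  have hroot := contDiffAt_rootParam (q := q) hy
  exact (contDiffAt_const.div (contDiffAt_const.mul (contDiffAt_snd.norm_sq ℝ))
    (by positivity)).mul ((hroot.add contDiffAt_const).add
      (contDiff_eccentricitySq.contDiffAt.div hroot (rootParam_pos q y).ne'))

lemma contDiffAt_position (hy : 0 < ‖y.2‖) : ContDiffAt ℝ ∞ (position q) y := by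
  have hw := rootParam_pos q y
  have hroot := contDiffAt_rootParam (q := q) hy
  have hdrift := contDiffAt_drift (q := q) (contDiffAt_norm_snd hy) hroot
    (contDiffAt_radius (q := q) hy) hy hw
  exact ((hroot.add contDiffAt_const).div hroot hw.ne').smul
    (contDiffAt_fst.sub (hdrift.smul contDiffAt_snd))

lemma contDiffAt_velocity (hq : 0 < q) (hy : 0 < ‖y.2‖) : ContDiffAt ℝ ∞ (velocity q) y := by
  have hw := rootParam_pos q y
  have hroot := contDiffAt_rootParam (q := q) hy
  exact ((hroot.add contDiffAt_const).inv (by positivity)).smul ((hroot.smul contDiffAt_snd).sub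
    (((contDiffAt_norm_snd hy).div (contDiffAt_radius hy) (radius_pos hq hy).ne').smul
      (contDiffAt_position hy)))

lemma contDiffAt_ofActionAngle (hq : 0 < q) (hy : 0 < ‖y.2‖) :
    ContDiffAt ℝ ∞ (ofActionAngle q) y :=
  (contDiffAt_position hy).prodMk (contDiffAt_velocity hq hy)

lemma fderiv_actionAngle (hq : 0 < q) (hz : 0 < ‖z.1‖) (ξ : E × E) :
    fderiv ℝ (actionAngle q) z ξ = (fderiv ℝ (angle q) z ξ, fderiv ℝ (action q) z ξ) :=
  congrArg (fun L => L ξ) <| DifferentiableAt.fderiv_prodMk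
    ((contDiffAt_angle hq hz).differentiableAt (by simp))
    ((contDiffAt_action hq hz).differentiableAt (by simp))

lemma fderiv_actionAngle_comp_fderiv_ofActionAngle (hq : 0 < q) (hz : 0 < ‖z.1‖) :
    fderiv ℝ (actionAngle q) z ∘L fderiv ℝ (ofActionAngle q) (actionAngle q z) =
      .id ℝ (E × E) := by
  have hy := norm_snd_actionAngle_pos hq hz
  have houter := ((contDiffAt_actionAngle hq hz).differentiableAt (by simp)).hasFDerivAt
  have hinner := ((contDiffAt_ofActionAngle hq hy).differentiableAt (by simp)).hasFDerivAt
  rw [← ofActionAngle_actionAngle hq hz] at houter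
  have hcomp := houter.comp _ hinner
  rw [ofActionAngle_actionAngle hq hz] at hcomp
  refine hcomp.unique ((hasFDerivAt_id _).congr_of_eventuallyEq ?_)
  filter_upwards [continuous_snd.norm.continuousAt.eventually_const_lt hy] with y' hy'
  exact actionAngle_ofActionAngle hq hy'

lemma surjective_fderiv_actionAngle (hq : 0 < q) (hz : 0 < ‖z.1‖) :
    Function.Surjective (fderiv ℝ (actionAngle q) z) := fun η =>
  ⟨_, congrArg (fun L => L η) (fderiv_actionAngle_comp_fderiv_ofActionAngle hq hz)⟩

end

/-! ### The action-angle map is canonical -/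

section

variable {E : Type*} [NormedAddCommGroup E] [InnerProductSpace ℝ E] {q : ℝ} {z : E × E}

lemma differentiableAt_speed (hq : 0 < q) (hz : 0 < ‖z.1‖) : DifferentiableAt ℝ (speed q) z :=
  (contDiffAt_speed hq hz).differentiableAt (by simp)

lemma differentiableAt_orbitParam (hq : 0 < q) (hz : 0 < ‖z.1‖) :
    DifferentiableAt ℝ (orbitParam q) z :=
  (contDiffAt_orbitParam hq hz).differentiableAt (by simp)

lemma differentiableAt_action (hq : 0 < q) (hz : 0 < ‖z.1‖) : DifferentiableAt ℝ (action q) z :=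
  (contDiffAt_action hq hz).differentiableAt (by simp)

lemma inner_action_fderiv_action (hq : 0 < q) (hz : 0 < ‖z.1‖) (ξ : E × E) :
    ⟪action q z, fderiv ℝ (action q) z ξ⟫ = speed q z * fderiv ℝ (speed q) z ξ :=
  inner_fderiv_of_norm_eventuallyEq (differentiableAt_action hq hz) (differentiableAt_speed hq hz)
    ((eventually_norm_fst_pos hz).mono fun _ => norm_action hq) ξ

lemma inner_fst_fderiv_radial (hq : 0 < q) (hz : 0 < ‖z.1‖) (ξ : E × E) :
    ⟪z.1, fderiv ℝ (radial q) z ξ⟫ = ‖z.1‖ * fderiv ℝ (speed q) z ξ := by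
  have hα := speed_pos hq hz
  have h := inner_fderiv_of_norm_eventuallyEq
    ((contDiffAt_radial hq hz).differentiableAt (by simp)) (differentiableAt_speed hq hz)
    ((eventually_norm_fst_pos hz).mono fun _ => norm_radial hq) ξ
  nth_rw 1 [radial] at h
  rw [real_inner_smul_left] at h
  field_simp at h
  exact h

lemma orbitParam_smul_fderiv_action (hq : 0 < q) (hz : 0 < ‖z.1‖) (ξ : E × E) :
    orbitParam q z • fderiv ℝ (action q) z ξ + fderiv ℝ (orbitParam q) z ξ • action q z =
      (orbitParam q z + 1) • ξ.2 + fderiv ℝ (orbitParam q) z ξ • z.2 +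
        fderiv ℝ (radial q) z ξ := by
  have hparam := (differentiableAt_orbitParam hq hz).hasFDerivAt
  have hradial := ((contDiffAt_radial hq hz).differentiableAt (by simp)).hasFDerivAt
  have hleft := hparam.smul (differentiableAt_action hq hz).hasFDerivAt
  have hright := ((hparam.add_const 1).smul hasFDerivAt_snd).add hradial
  have heq : (fun z' => orbitParam q z' • action q z') =ᶠ[𝓝 z]
      fun z' => (orbitParam q z' + 1) • z'.2 + radial q z' :=
    (eventually_norm_fst_pos hz).mono fun _ => orbitParam_smul_action hq
  exact congrArg (fun L => L ξ) (hleft.unique (hright.congr_of_eventuallyEq heq))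

lemma inner_fst_fderiv_action (hq : 0 < q) (hz : 0 < ‖z.1‖) (ξ : E × E) :
    orbitParam q z / (orbitParam q z + 1) * ⟪z.1, fderiv ℝ (action q) z ξ⟫ =
      ⟪z.1, ξ.2⟫ + ‖z.1‖ * fderiv ℝ (speed q) z ξ / (orbitParam q z + 1) -
        q * fderiv ℝ (orbitParam q) z ξ / (2 * speed q z * orbitParam q z) := by
  have hα := speed_pos hq hz
  have hw := orbitParam_pos hq hz
  have h := congrArg (fun u => ⟪z.1, u⟫) (orbitParam_smul_fderiv_action hq hz ξ)
  simp only [inner_add_right, inner_smul_right, inner_fst_fderiv_radial hq hz,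
    inner_fst_action hq hz, inner_fst_snd hq hz] at h
  rw [div_mul_eq_mul_div, eq_sub_of_add_eq h]
  field_simp
  ring

/-- The value of the generating function at corresponding points, as a function of `z = (x, v)`. It
is smooth across the fold. -/
noncomputable def generatingValue (q : ℝ) (z : E × E) : ℝ :=
  ⟪z.1, z.2⟫ - q / (2 * speed q z) * Real.log (orbitParam q z)

lemma contDiffAt_generatingValue (hq : 0 < q) (hz : 0 < ‖z.1‖) :
    ContDiffAt ℝ ∞ (generatingValue q) z := by
  have hα := speed_pos hq hz
  exact (contDiffAt_fst.inner ℝ contDiffAt_snd).sub ((contDiffAt_const.div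
    (contDiffAt_const.mul (contDiffAt_speed hq hz)) (by positivity)).mul
      ((contDiffAt_orbitParam hq hz).log (orbitParam_pos hq hz).ne'))

lemma fderiv_generatingValue_apply (hq : 0 < q) (hz : 0 < ‖z.1‖) (ξ : E × E) :
    fderiv ℝ (generatingValue q) z ξ = ⟪z.1, ξ.2⟫ + ⟪ξ.1, z.2⟫
      + q * fderiv ℝ (speed q) z ξ / (2 * speed q z ^ 2) * Real.log (orbitParam q z)
      - q * fderiv ℝ (orbitParam q) z ξ / (2 * speed q z * orbitParam q z) := by
  have hα := speed_pos hq hz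
  have hw := orbitParam_pos hq hz
  have hinner := (hasFDerivAt_fst (𝕜 := ℝ) (p := z)).inner ℝ (hasFDerivAt_snd (𝕜 := ℝ) (p := z))
  have hspeed := ((hasDerivAt_inv hα.ne').comp_hasFDerivAt z
    (differentiableAt_speed hq hz).hasFDerivAt).const_mul (q / 2)
  have hlog := (differentiableAt_orbitParam hq hz).hasFDerivAt.log hw.ne'
  have hvalue : generatingValue q =
      fun z : E × E => ⟪z.1, z.2⟫ - q / 2 * (speed q z)⁻¹ * Real.log (orbitParam q z) := by
    funext z
    rw [generatingValue, ← div_div, div_eq_mul_inv (q / 2)]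
  have hderiv := congrArg (fun L => L ξ) (hinner.sub (hspeed.mul hlog)).fderiv
  rw [hvalue]
  refine hderiv.trans ?_
  simp only [Prod.mk.eta, ContinuousLinearMap.fst_prod_snd, ContinuousLinearMap.comp_id,
    Function.comp_apply, neg_smul, smul_neg, sub_apply, fderivInnerCLM_apply, add_apply,
    smul_apply, smul_eq_mul, neg_apply]
  field_simp
  ring

lemma fderiv_generatingValue (hq : 0 < q) (hz : 0 < ‖z.1‖) (ξ : E × E) :
    fderiv ℝ (generatingValue q) z ξ = ⟪z.2, ξ.1⟫ + ⟪angle q z, fderiv ℝ (action q) z ξ⟫ := by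
  have hα := speed_pos hq hz
  rw [fderiv_generatingValue_apply hq hz, angle, inner_add_left, real_inner_smul_left,
    real_inner_smul_left, inner_fst_fderiv_action hq hz, inner_action_fderiv_action hq hz, drift,
    real_inner_comm ξ.1]
  field_simp
  ring

lemma symplecticForm_fderiv_actionAngle (hq : 0 < q) (hz : 0 < ‖z.1‖) (ξ ζ : E × E) :
    symplecticForm (fderiv ℝ (actionAngle q) z ξ) (fderiv ℝ (actionAngle q) z ζ) =
      symplecticForm ξ ζ := by
  rw [fderiv_actionAngle hq hz, fderiv_actionAngle hq hz]
  exact symplecticForm_fderiv_of_exact ((contDiffAt_generatingValue hq hz).of_le (by norm_cast))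
    ((contDiffAt_angle hq hz).differentiableAt (by simp))
    ((contDiffAt_action hq hz).of_le (by norm_cast))
    ((eventually_norm_fst_pos hz).mono fun _ => fderiv_generatingValue hq) ξ ζ

end

/-! ### Linearization of the flow -/

section

variable {E : Type*} [NormedAddCommGroup E] [InnerProductSpace ℝ E] {q : ℝ} {z : E × E}

lemma speed_mul_fderiv_speed (hq : 0 < q) (hz : 0 < ‖z.1‖) (ζ : E × E) :
    speed q z * fderiv ℝ (speed q) z ζ = ⟪z.2, ζ.2⟫ - q / 2 / ‖z.1‖ ^ 3 * ⟪z.1, ζ.1⟫ := by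
  have hsq : (fun z' : E × E => speed q z' ^ 2) =ᶠ[𝓝 z]
      fun z' => ‖z'.2‖ ^ 2 + q * ‖z'.1‖⁻¹ :=
    (eventually_norm_fst_pos hz).mono fun _ => speed_sq hq
  have hspeed := (differentiableAt_speed hq hz).hasFDerivAt.pow 2
  have hkinetic := (hasFDerivAt_snd (𝕜 := ℝ) (p := z)).norm_sq
  have hpotential := ((hasDerivAt_inv hz.ne').comp_hasFDerivAt z
    ((hasFDerivAt_norm hz).comp z hasFDerivAt_fst)).const_mul q
  have h := congrArg (fun L => L ζ) <|
    hspeed.unique ((hkinetic.add hpotential).congr_of_eventuallyEq hsq)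
  simp only [Nat.cast_ofNat, Nat.add_one_sub_one, pow_one, nsmul_eq_mul, smul_apply, smul_eq_mul,
    add_apply, ContinuousLinearMap.comp_apply, coe_innerSL_apply,
    ContinuousLinearMap.coe_fst', ContinuousLinearMap.coe_snd'] at h
  field_simp at h ⊢
  linarith

/-- The vector field of the repulsive Kepler system. -/
noncomputable def keplerField (q : ℝ) (z : E × E) : E × E := (z.2, (q / 2 / ‖z.1‖ ^ 3) • z.1)

lemma fderiv_actionAngle_keplerField (hq : 0 < q) (hz : 0 < ‖z.1‖) :
    fderiv ℝ (actionAngle q) z (keplerField q z) = (action q z, 0) := by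
  refine map_eq_of_symplecticForm_eq (symplecticForm_fderiv_actionAngle hq hz)
    (surjective_fderiv_actionAngle hq hz) fun ζ => ?_
  rw [fderiv_actionAngle hq hz]
  simp only [symplecticForm, keplerField, inner_zero_left, sub_zero, real_inner_smul_left,
    inner_action_fderiv_action hq hz, speed_mul_fderiv_speed hq hz]

lemma fderiv_ofActionAngle_action (hq : 0 < q) (hz : 0 < ‖z.1‖) :
    fderiv ℝ (ofActionAngle q) (actionAngle q z) (action q z, 0) = keplerField q z := by
  refine injective_of_symplecticForm_map (symplecticForm_fderiv_actionAngle hq hz) ?_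
  rw [fderiv_actionAngle_keplerField hq hz]
  exact congrArg (fun L => L (action q z, (0 : E)))
    (fderiv_actionAngle_comp_fderiv_ofActionAngle hq hz)

lemma actionAngle_of_isIntegralCurveOn (hq : 0 < q) {I : Set ℝ} (hI : I.OrdConnected)
    (h0 : (0 : ℝ) ∈ I) {γ : ℝ → E × E} (hpos : ∀ t ∈ I, 0 < ‖(γ t).1‖)
    (hγ : IsIntegralCurveOn γ (fun _ => keplerField q) I) {t : ℝ} (ht : t ∈ I) :
    angle q (γ t) = angle q (γ 0) + t • action q (γ 0) ∧ action q (γ t) = action q (γ 0) := by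
  have hderiv (s : ℝ) (hs : s ∈ I) :
      HasDerivWithinAt (fun s => actionAngle q (γ s)) (action q (γ s), 0) I s := by
    rw [← fderiv_actionAngle_keplerField hq (hpos s hs)]
    exact ((contDiffAt_actionAngle hq (hpos s hs)).differentiableAt
      (by simp)).hasFDerivAt.comp_hasDerivWithinAt s (hγ s hs)
  have haction (s : ℝ) (hs : s ∈ I) : action q (γ s) = action q (γ 0) :=
    eq_of_hasDerivWithinAt_zero hI (fun u hu => (hderiv u hu).snd) h0 hs
  have hangle : angle q (γ t) - t • action q (γ 0) = angle q (γ 0) - (0 : ℝ) • action q (γ 0) := by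
    refine eq_of_hasDerivWithinAt_zero hI
      (f := fun s => angle q (γ s) - s • action q (γ 0)) (fun s hs => ?_) h0 ht
    have hfst : HasDerivWithinAt (fun s => angle q (γ s)) (action q (γ s)) I s := (hderiv s hs).fst
    have hsub := hfst.sub ((hasDerivWithinAt_id s I).smul_const (action q (γ 0)))
    rwa [one_smul, haction s hs, sub_self] at hsub
  rw [zero_smul, sub_zero, sub_eq_iff_eq_add] at hangle
  exact ⟨hangle, haction t ht⟩

lemma hasDerivAt_ofActionAngle_add_smul (hq : 0 < q) (ϑ : E) {a : E} (ha : 0 < ‖a‖) (t : ℝ) :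
    HasDerivAt (fun t : ℝ => ofActionAngle q (ϑ + t • a, a))
      (keplerField q (ofActionAngle q (ϑ + t • a, a))) t := by
  set y : E × E := (ϑ + t • a, a)
  have hline : HasDerivAt (fun t : ℝ => (ϑ + t • a, a)) (a, (0 : E)) t := by
    have h := (((hasDerivAt_id t).smul_const a).const_add ϑ).prodMk (hasDerivAt_const t a)
    rwa [one_smul] at h
  have hfield := fderiv_ofActionAngle_action hq (norm_fst_ofActionAngle_pos hq (y := y) ha)
  rw [actionAngle_ofActionAngle hq ha, action_ofActionAngle hq ha] at hfield
  rw [← hfield]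
  exact ((contDiffAt_ofActionAngle hq ha).differentiableAt
    (by simp)).hasFDerivAt.comp_hasDerivAt t hline

lemma isIntegralCurveOn_of_actionAngle (hq : 0 < q) {I : Set ℝ} {γ : ℝ → E × E}
    (hpos : ∀ t ∈ I, 0 < ‖(γ t).1‖) {ϑ a : E} (ha : 0 < ‖a‖)
    (hγ : ∀ t ∈ I, angle q (γ t) = ϑ + t • a ∧ action q (γ t) = a) :
    IsIntegralCurveOn γ (fun _ => keplerField q) I := by
  have hcurve (t : ℝ) (ht : t ∈ I) : γ t = ofActionAngle q (ϑ + t • a, a) := by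
    rw [← ofActionAngle_actionAngle hq (hpos t ht), actionAngle, (hγ t ht).1, (hγ t ht).2]
  intro t ht
  rw [hcurve t ht]
  exact (hasDerivAt_ofActionAngle_add_smul hq ϑ ha t).hasDerivWithinAt.congr hcurve (hcurve t ht)

end

/-! ### The asymptotic action property -/

section

variable {E : Type*} [NormedAddCommGroup E] [InnerProductSpace ℝ E] {q : ℝ} {y : E × E}

lemma eccentricitySq_add_smul (q : ℝ) (ϑ a : E) (t : ℝ) :
    eccentricitySq q (ϑ + t • a, a) = eccentricitySq q (ϑ, a) := by
  simp only [eccentricitySq, gramDet_add_smul_left]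

lemma orbitPhase_add_smul (q : ℝ) (ϑ a : E) (t : ℝ) :
    orbitPhase q (ϑ + t • a, a) = orbitPhase q (ϑ, a) + 4 * ‖a‖ ^ 3 / q * t := by
  simp only [orbitPhase, inner_add_left, real_inner_smul_left, real_inner_self_eq_norm_sq]
  ring

lemma rootParam_add_smul (q : ℝ) (ϑ a : E) (t : ℝ) :
    rootParam q (ϑ + t • a, a) =
      keplerRoot (eccentricitySq q (ϑ, a)) (orbitPhase q (ϑ, a) + 4 * ‖a‖ ^ 3 / q * t) := by
  rw [rootParam, eccentricitySq_add_smul, orbitPhase_add_smul]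

lemma tendsto_orbitPhase_add_smul (hq : 0 < q) (ϑ : E) {a : E} (ha : 0 < ‖a‖) :
    Tendsto (fun t : ℝ => orbitPhase q (ϑ, a) + 4 * ‖a‖ ^ 3 / q * t) atTop atTop :=
  tendsto_atTop_add_const_left _ _ (tendsto_id.const_mul_atTop (by positivity))

lemma tendsto_rootParam_add_smul (hq : 0 < q) (ϑ : E) {a : E} (ha : 0 < ‖a‖) :
    Tendsto (fun t : ℝ => rootParam q (ϑ + t • a, a)) atTop atTop := by
  simp only [rootParam_add_smul]
  exact (tendsto_keplerRoot_atTop (eccentricitySq_pos _ _).le).comp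
    (tendsto_orbitPhase_add_smul hq ϑ ha)

lemma isLittleO_log_rootParam_add_smul (hq : 0 < q) (ϑ : E) {a : E} (ha : 0 < ‖a‖) :
    (fun t : ℝ => Real.log (rootParam q (ϑ + t • a, a))) =o[atTop] (fun t : ℝ => t) := by
  simp only [rootParam_add_smul]
  refine ((isLittleO_log_keplerRoot (eccentricitySq_pos q (ϑ, a)).le).comp_tendsto
    (tendsto_orbitPhase_add_smul hq ϑ ha)).trans_isBigO ?_
  exact (isLittleO_const_id_atTop _).isBigO.add (isBigO_const_mul_self _ _ _)

lemma radius_div_le (hq : 0 < q) (hw : 1 ≤ rootParam q y) :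
    radius q y / (rootParam q y + 1) ≤ q / (4 * ‖y.2‖ ^ 2) * (2 + eccentricitySq q y) := by
  have hc := eccentricitySq_pos q y
  have hdiv : eccentricitySq q y / rootParam q y ≤ eccentricitySq q y := div_le_self hc.le hw
  rw [radius, mul_div_assoc]
  gcongr
  rw [div_le_iff₀ (by positivity)]
  linarith [mul_le_mul_of_nonneg_left hw hc.le]

lemma norm_drift_smul_le (hq : 0 < q) (hy : 0 < ‖y.2‖) (hw : 1 ≤ rootParam q y) :
    ‖drift q ‖y.2‖ (rootParam q y) (radius q y) • y.2‖ ≤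
      q / (2 * ‖y.2‖ ^ 2) * Real.log (rootParam q y) + radius q y / (rootParam q y + 1) := by
  have hr := radius_pos hq hy
  have hlog := Real.log_nonneg hw
  rw [norm_smul, drift, Real.norm_eq_abs]
  calc _ ≤ (|q * Real.log (rootParam q y) / (2 * ‖y.2‖ ^ 3)| +
        |radius q y / (‖y.2‖ * (rootParam q y + 1))|) * ‖y.2‖ := by
        gcongr
        exact abs_sub _ _
    _ = _ := by
        rw [abs_of_nonneg (by positivity), abs_of_nonneg (by positivity)]
        field_simp

lemma norm_position_sub_fst_le (hq : 0 < q) (hy : 0 < ‖y.2‖) (hw : 1 ≤ rootParam q y) :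
    ‖position q y - y.1‖ ≤
      q / (2 * ‖y.2‖ ^ 2) * (2 + eccentricitySq q y + Real.log (rootParam q y)) := by
  set w := rootParam q y with hw_def
  have hsub : position q y - y.1 =
      (w + 1)⁻¹ • position q y - drift q ‖y.2‖ w (radius q y) • y.2 := by
    have hscaled : (w / (w + 1)) • position q y = y.1 - drift q ‖y.2‖ w (radius q y) • y.2 := by
      rw [position, ← hw_def, smul_smul, div_mul_div_cancel₀ (by positivity),
        div_self (by positivity), one_smul]
    have hsplit : position q y = (w / (w + 1)) • position q y + (w + 1)⁻¹ • position q y := by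
      rw [← add_smul, ← one_div, ← add_div, div_self (by positivity), one_smul]
    nth_rw 1 [hsplit, hscaled]
    abel
  have hposition : ‖(w + 1)⁻¹ • position q y‖ = radius q y / (w + 1) := by
    rw [norm_smul, norm_position hq hy, Real.norm_of_nonneg (by positivity), inv_mul_eq_div]
  calc ‖position q y - y.1‖
      ≤ radius q y / (w + 1) + (q / (2 * ‖y.2‖ ^ 2) * Real.log w + radius q y / (w + 1)) := by
        rw [hsub]
        refine (norm_sub_le _ _).trans ?_
        rw [hposition]
        exact add_le_add_right (norm_drift_smul_le hq hy hw) _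
    _ = 2 * (radius q y / (w + 1)) + q / (2 * ‖y.2‖ ^ 2) * Real.log w := by ring
    _ ≤ 2 * (q / (4 * ‖y.2‖ ^ 2) * (2 + eccentricitySq q y)) +
        q / (2 * ‖y.2‖ ^ 2) * Real.log w := by
        gcongr
        exact radius_div_le hq hw
    _ = q / (2 * ‖y.2‖ ^ 2) * (2 + eccentricitySq q y + Real.log w) := by
        field_simp
        ring

lemma norm_velocity_sub_snd_le (hq : 0 < q) (hy : 0 < ‖y.2‖) :
    ‖velocity q y - y.2‖ ≤ 2 * ‖y.2‖ * (rootParam q y + 1)⁻¹ := by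
  have hw := rootParam_pos q y
  have hr := radius_pos hq hy
  have hsub : velocity q y - y.2 =
      (rootParam q y + 1)⁻¹ • (-y.2 - (‖y.2‖ / radius q y) • position q y) := by
    rw [velocity, sub_eq_iff_eq_add, ← sub_eq_iff_eq_add', ← smul_sub,
      inv_smul_eq_iff₀ (by positivity)]
    module
  have hradial : ‖(‖y.2‖ / radius q y) • position q y‖ = ‖y.2‖ := by
    rw [norm_smul, norm_position hq hy, Real.norm_of_nonneg (by positivity),
      div_mul_cancel₀ _ hr.ne']
  rw [hsub, norm_smul, Real.norm_of_nonneg (by positivity), mul_comm]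
  gcongr
  refine (norm_sub_le _ _).trans_eq ?_
  rw [norm_neg, hradial, two_mul]

lemma isLittleO_position_sub_smul (hq : 0 < q) (ϑ : E) {a : E} (ha : 0 < ‖a‖) :
    (fun t : ℝ => ‖position q (ϑ + t • a, a) - t • a‖) =o[atTop] (fun t : ℝ => t) := by
  have hbound : (fun t : ℝ => q / (2 * ‖a‖ ^ 2) * (2 + eccentricitySq q (ϑ, a) +
      Real.log (rootParam q (ϑ + t • a, a)))) =o[atTop] (fun t : ℝ => t) :=
    ((isLittleO_const_id_atTop _).add (isLittleO_log_rootParam_add_smul hq ϑ ha)).const_mul_left _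
  have hshift : (fun t : ℝ => position q (ϑ + t • a, a) - (ϑ + t • a)) =o[atTop]
      (fun t : ℝ => t) := by
    refine IsBigO.trans_isLittleO (IsBigO.of_bound' ?_) hbound
    filter_upwards [(tendsto_rootParam_add_smul hq ϑ ha).eventually_ge_atTop 1] with t ht
    have h := norm_position_sub_fst_le hq (y := (ϑ + t • a, a)) ha ht
    rw [eccentricitySq_add_smul] at h
    exact h.trans (le_abs_self _)
  refine (hshift.add (isLittleO_const_id_atTop ϑ)).norm_left.congr_left fun t => ?_
  congr 1
  abel

lemma tendsto_velocity_sub (hq : 0 < q) (ϑ : E) {a : E} (ha : 0 < ‖a‖) :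
    Tendsto (fun t : ℝ => ‖velocity q (ϑ + t • a, a) - a‖) atTop (𝓝 0) := by
  have hbound : Tendsto (fun t : ℝ => 2 * ‖a‖ * (rootParam q (ϑ + t • a, a) + 1)⁻¹)
      atTop (𝓝 0) := by
    have h := (tendsto_atTop_add_const_right _ 1
      (tendsto_rootParam_add_smul hq ϑ ha)).inv_tendsto_atTop.const_mul (2 * ‖a‖)
    rwa [mul_zero] at h
  exact squeeze_zero (fun _ => norm_nonneg _)
    (fun t => norm_velocity_sub_snd_le hq (y := (ϑ + t • a, a)) ha) hbound

end

/-! ### The generating functions and the fold -/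

section

variable {E : Type*} [NormedAddCommGroup E] [InnerProductSpace ℝ E] {q ι : ℝ} {x a : E} {z : E × E}

lemma sqrt_sq_div_four_mul {c : ℝ} (hc : 0 ≤ c) (w : ℝ) : √(c ^ 2 / (4 * w)) = c / (2 * √w) := by
  rw [Real.sqrt_div (sq_nonneg _), Real.sqrt_sq hc, Real.sqrt_mul (by norm_num),
    show (4 : ℝ) = 2 ^ 2 by norm_num, Real.sqrt_sq (by norm_num)]

lemma sq_div_four_mul_sub_one {w : ℝ} (hw : w ≠ 0) :
    (w + 1) ^ 2 / (4 * w) - 1 = (w - 1) ^ 2 / (4 * w) := by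
  field_simp
  ring

lemma sq_div_four_mul_inv {w : ℝ} (hw : w ≠ 0) :
    (w⁻¹ + 1) ^ 2 / (4 * w⁻¹) = (w + 1) ^ 2 / (4 * w) := by
  field_simp
  ring

lemma K_sq_div_four_mul {w : ℝ} (hw : 1 ≤ w) :
    Kepler.K ((w + 1) ^ 2 / (4 * w)) = (w - w⁻¹) / 4 - Real.log w / 2 := by
  have hw0 : 0 < w := one_pos.trans_le hw
  have hsq : √w ^ 2 = w := Real.sq_sqrt hw0.le
  have hsum : (w + 1) / (2 * √w) + (w - 1) / (2 * √w) = √w := by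
    field_simp
    rw [hsq]
    ring
  rw [Kepler.K, Real.sqrt_mul (by positivity), sq_div_four_mul_sub_one hw0.ne',
    sqrt_sq_div_four_mul (by positivity), sqrt_sq_div_four_mul (sub_nonneg.2 hw), hsum,
    Real.log_sqrt hw0.le]
  field_simp
  rw [hsq]
  ring

lemma hasDerivAt_K {s : ℝ} (hs : 1 < s) : HasDerivAt Kepler.K (√(s - 1) / √s) s := by
  have hs0 : 0 < s := one_pos.trans hs
  have hs1 : 0 < s - 1 := sub_pos.2 hs
  have hsub := (hasDerivAt_id' s).sub_const 1
  have hroot := ((hasDerivAt_id' s).fun_mul hsub).sqrt (mul_pos hs0 hs1).ne'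
  have hlog := (((hasDerivAt_id' s).sqrt hs0.ne').fun_add (hsub.sqrt hs1.ne')).log
    (add_pos (Real.sqrt_pos.2 hs0) (Real.sqrt_pos.2 hs1)).ne'
  refine HasDerivAt.congr_deriv (hroot.fun_sub hlog) ?_
  rw [Real.sqrt_mul hs0.le]
  field_simp
  rw [Real.sq_sqrt hs1.le]
  ring

lemma hasDerivAt_K_sq_div_four_mul {w : ℝ} (hw : 1 < w) :
    HasDerivAt Kepler.K ((w - 1) / (w + 1)) ((w + 1) ^ 2 / (4 * w)) := by
  have hw0 : 0 < w := one_pos.trans hw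
  have hsub := sub_pos.2 hw
  have hone : 1 < (w + 1) ^ 2 / (4 * w) := by
    rw [← sub_pos, sq_div_four_mul_sub_one hw0.ne']
    positivity
  refine (hasDerivAt_K hone).congr_deriv ?_
  rw [sq_div_four_mul_sub_one hw0.ne', sqrt_sq_div_four_mul hsub.le,
    sqrt_sq_div_four_mul (by positivity), div_div_div_cancel_right₀ (by positivity)]

/- The substitution `w ↦ w⁻¹` exchanges the two sides of the fold. It leaves `(w + 1) ^ 2 / (4 * w)`
invariant and reverses the sign of the right-hand side. -/
lemma mul_K_sq_div_four_mul {w : ℝ} (hw : 0 < w) (hι : ι = 1 ∧ 1 < w ∨ ι = -1 ∧ w < 1) :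
    ι * Kepler.K ((w + 1) ^ 2 / (4 * w)) = (w - w⁻¹) / 4 - Real.log w / 2 := by
  rcases hι with ⟨rfl, hw1⟩ | ⟨rfl, hw1⟩
  · rw [one_mul, K_sq_div_four_mul hw1.le]
  · rw [← sq_div_four_mul_inv hw.ne', K_sq_div_four_mul (one_le_inv_iff₀.2 ⟨hw, hw1.le⟩), inv_inv,
      Real.log_inv]
    ring

lemma hasDerivAt_mul_K_sq_div_four_mul {w : ℝ} (hw : 0 < w)
    (hι : ι = 1 ∧ 1 < w ∨ ι = -1 ∧ w < 1) :
    HasDerivAt (fun s => ι * Kepler.K s) ((w - 1) / (w + 1)) ((w + 1) ^ 2 / (4 * w)) := by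
  rcases hι with ⟨rfl, hw1⟩ | ⟨rfl, hw1⟩
  · simpa only [one_mul] using hasDerivAt_K_sq_div_four_mul hw1
  · have h := hasDerivAt_K_sq_div_four_mul ((one_lt_inv₀ hw).2 hw1)
    rw [sq_div_four_mul_inv hw.ne'] at h
    refine (h.const_mul (-1)).congr_deriv ?_
    field_simp
    ring

/-- The function `ρ(x, a)`, on an arbitrary inner product space. -/
noncomputable def rho (q : ℝ) (x a : E) : ℝ := ‖a‖ / (2 * q) * (⟪x, a⟫ + ‖x‖ * ‖a‖)

/-- The generating function `S_ι(x, a)`, on an arbitrary inner product space. -/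
noncomputable def generating (q ι : ℝ) (x a : E) : ℝ :=
  ι * (q / ‖a‖) * Kepler.K (rho q x a) - (‖x‖ * ‖a‖ - ⟪x, a⟫) / 2

/-- The function whose zero set is the fold, on an arbitrary inner product space. -/
noncomputable def foldFunction (q : ℝ) (z : E × E) : ℝ :=
  ⟪z.1, z.2⟫ + speed q z * gramDet z.1 z.2 / q

/-- The map `T = (Θ, 𝒜)` is generated by `S_ι` at `z = (x, v)`, that is, `v = ∇ₓ S_ι(x, a)` and
`Θ(z) = ∇ₐ S_ι(x, a)` for `a = 𝒜(z)`. Gradients are expressed through the Fréchet derivative because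
`E` need not be complete. -/
def GeneratedAt (q ι : ℝ) (T : E × E → E × E) (z : E × E) : Prop :=
  HasFDerivAt (fun y => generating q ι y (T z).2) (innerSL ℝ z.2) z.1 ∧
    HasFDerivAt (fun b => generating q ι z.1 b) (innerSL ℝ (T z).1) (T z).2

lemma hasFDerivAt_inner_const (x a : E) : HasFDerivAt (fun y : E => ⟪y, a⟫) (innerSL ℝ a) x := by
  simpa only [real_inner_comm, coe_innerSL_apply] using (innerSL ℝ a).hasFDerivAt (x := x)

lemma hasFDerivAt_rho_left (a : E) (hx : 0 < ‖x‖) :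
    HasFDerivAt (fun y => rho q y a)
      (innerSL ℝ ((‖a‖ / (2 * q)) • (a + (‖a‖ / ‖x‖) • x))) x := by
  refine (((hasFDerivAt_inner_const x a).fun_add
    ((hasFDerivAt_norm hx).mul_const ‖a‖)).const_mul (‖a‖ / (2 * q))).congr_fderiv ?_
  simp only [map_add, map_smulₛₗ, RCLike.conj_to_real, smul_smul, div_eq_mul_inv ‖a‖ ‖x‖]

lemma hasFDerivAt_rho_right (x : E) (ha : 0 < ‖a‖) :
    HasFDerivAt (fun b => rho q x b)
      (innerSL ℝ ((2 * q)⁻¹ • (‖a‖ • x + (⟪x, a⟫ / ‖a‖ + 2 * ‖x‖) • a))) a := by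
  have hnorm := hasFDerivAt_norm ha
  refine ((hnorm.mul_const (2 * q)⁻¹).fun_mul
    ((innerSL ℝ x).hasFDerivAt.fun_add (hnorm.const_mul ‖x‖))).congr_fderiv ?_
  simp only [map_add, map_smulₛₗ, RCLike.conj_to_real, coe_innerSL_apply]
  match_scalars
  · ring
  · field_simp
    ring

lemma hasFDerivAt_generating_left (hq : q ≠ 0) (hx : 0 < ‖x‖) (ha : 0 < ‖a‖) {κ : ℝ}
    (hκ : HasDerivAt (fun s => ι * Kepler.K s) κ (rho q x a)) :
    HasFDerivAt (fun y => generating q ι y a)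
      (innerSL ℝ (((1 + κ) / 2) • a - ((1 - κ) / 2 * (‖a‖ / ‖x‖)) • x)) x := by
  have hK := (hκ.comp_hasFDerivAt x (hasFDerivAt_rho_left a hx)).const_mul (q / ‖a‖)
  have hlinear := (((hasFDerivAt_norm hx).mul_const ‖a‖).fun_sub
    (hasFDerivAt_inner_const x a)).mul_const 2⁻¹
  have h := (hK.fun_sub hlinear).congr_of_eventuallyEq (f₁ := fun y => generating q ι y a)
    (.of_forall fun y => by simp only [generating, Function.comp_apply]; ring)
  refine h.congr_fderiv ?_
  simp only [map_add, map_sub, map_smulₛₗ, RCLike.conj_to_real]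
  match_scalars
  · field_simp
    ring
  · field_simp
    ring

lemma hasFDerivAt_generating_right (hq : q ≠ 0) (x : E) (ha : 0 < ‖a‖) {κ : ℝ}
    (hκ : HasDerivAt (fun s => ι * Kepler.K s) κ (rho q x a)) :
    HasFDerivAt (fun b => generating q ι x b)
      (innerSL ℝ (((1 + κ) / 2) • x + (κ * (⟪x, a⟫ + 2 * ‖x‖ * ‖a‖) / (2 * ‖a‖ ^ 2) -
        ‖x‖ / (2 * ‖a‖) - q * (ι * Kepler.K (rho q x a)) / ‖a‖ ^ 3) • a)) a := by
  have hnorm := hasFDerivAt_norm ha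
  have hinv := ((hasDerivAt_inv ha.ne').comp_hasFDerivAt a hnorm).const_mul q
  have hK := hinv.fun_mul (hκ.comp_hasFDerivAt a (hasFDerivAt_rho_right x ha))
  have hlinear := ((hnorm.const_mul ‖x‖).fun_sub (innerSL ℝ x).hasFDerivAt).mul_const 2⁻¹
  have h := (hK.fun_sub hlinear).congr_of_eventuallyEq (f₁ := fun b => generating q ι x b)
    (.of_forall fun b => by
      simp only [generating, Function.comp_apply, coe_innerSL_apply]
      ring)
  refine h.congr_fderiv ?_
  simp only [map_add, map_smulₛₗ, RCLike.conj_to_real, Function.comp_apply]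
  match_scalars
  · field_simp
    ring
  · field_simp
    ring

lemma rho_action (hq : 0 < q) (hz : 0 < ‖z.1‖) :
    rho q z.1 (action q z) = (orbitParam q z + 1) ^ 2 / (4 * orbitParam q z) := by
  have hα := speed_pos hq hz
  have hw := orbitParam_pos hq hz
  rw [rho, norm_action hq hz, inner_fst_action hq hz]
  field_simp
  ring

lemma rho_action_sub_one (hq : 0 < q) (hz : 0 < ‖z.1‖) :
    rho q z.1 (action q z) - 1 = (orbitParam q z - 1) ^ 2 / (4 * orbitParam q z) := by
  rw [rho_action hq hz, sq_div_four_mul_sub_one (orbitParam_pos hq hz).ne']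

lemma one_le_rho_action (hq : 0 < q) (hz : 0 < ‖z.1‖) : 1 ≤ rho q z.1 (action q z) := by
  have hw := orbitParam_pos hq hz
  rw [← sub_nonneg, rho_action_sub_one hq hz]
  positivity

lemma rho_action_eq_one_iff (hq : 0 < q) (hz : 0 < ‖z.1‖) :
    rho q z.1 (action q z) = 1 ↔ orbitParam q z = 1 := by
  have hw := orbitParam_pos hq hz
  rw [← sub_eq_zero, rho_action_sub_one hq hz, div_eq_zero_iff, or_iff_left (by positivity),
    sq_eq_zero_iff, sub_eq_zero]

lemma foldFunction_eq (hq : 0 < q) (hz : 0 < ‖z.1‖) :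
    foldFunction q z = (speed q z * gramDet z.1 z.2 +
      q ^ 2 * (orbitParam q z + 1) / (4 * speed q z)) / (q * orbitParam q z) *
        (orbitParam q z - 1) := by
  have hα := speed_pos hq hz
  have hw := orbitParam_pos hq hz
  rw [foldFunction, inner_fst_snd hq hz, gramDet_fst_snd hq hz]
  field_simp
  ring

lemma exists_foldFunction_eq (hq : 0 < q) (hz : 0 < ‖z.1‖) :
    ∃ c, 0 < c ∧ foldFunction q z = c * (orbitParam q z - 1) := by
  have hα := speed_pos hq hz
  have hw := orbitParam_pos hq hz
  have hgram := gramDet_nonneg z.1 z.2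
  exact ⟨_, by positivity, foldFunction_eq hq hz⟩

lemma foldFunction_neg_iff (hq : 0 < q) (hz : 0 < ‖z.1‖) :
    foldFunction q z < 0 ↔ orbitParam q z < 1 := by
  obtain ⟨c, hc, h⟩ := exists_foldFunction_eq hq hz
  rw [h, ← neg_pos, ← mul_neg, mul_pos_iff_of_pos_left hc, neg_sub, sub_pos]

lemma foldFunction_pos_iff (hq : 0 < q) (hz : 0 < ‖z.1‖) :
    0 < foldFunction q z ↔ 1 < orbitParam q z := by
  obtain ⟨c, hc, h⟩ := exists_foldFunction_eq hq hz
  rw [h, mul_pos_iff_of_pos_left hc, sub_pos]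

lemma foldFunction_eq_zero_iff (hq : 0 < q) (hz : 0 < ‖z.1‖) :
    foldFunction q z = 0 ↔ orbitParam q z = 1 := by
  obtain ⟨c, hc, h⟩ := exists_foldFunction_eq hq hz
  rw [h, mul_eq_zero, or_iff_right hc.ne', sub_eq_zero]

lemma hasFDerivAt_generating_action_left (hq : 0 < q) (hz : 0 < ‖z.1‖)
    (hι : ι = 1 ∧ 1 < orbitParam q z ∨ ι = -1 ∧ orbitParam q z < 1) :
    HasFDerivAt (fun y => generating q ι y (action q z)) (innerSL ℝ z.2) z.1 := by
  have hw := orbitParam_pos hq hz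
  have ha : 0 < ‖action q z‖ := norm_snd_actionAngle_pos hq hz
  have hκ := hasDerivAt_mul_K_sq_div_four_mul hw hι
  rw [← rho_action hq hz] at hκ
  refine (hasFDerivAt_generating_left hq.ne' hz ha hκ).congr_fderiv (congrArg _ ?_)
  rw [norm_action hq hz, action, radial]
  match_scalars
  · field_simp
    ring
  · field_simp
    ring

lemma hasFDerivAt_generating_action_right (hq : 0 < q) (hz : 0 < ‖z.1‖)
    (hι : ι = 1 ∧ 1 < orbitParam q z ∨ ι = -1 ∧ orbitParam q z < 1) :
    HasFDerivAt (fun b => generating q ι z.1 b) (innerSL ℝ (angle q z)) (action q z) := by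
  have hα := speed_pos hq hz
  have hw := orbitParam_pos hq hz
  have ha : 0 < ‖action q z‖ := norm_snd_actionAngle_pos hq hz
  have hκ := hasDerivAt_mul_K_sq_div_four_mul hw hι
  rw [← rho_action hq hz] at hκ
  refine (hasFDerivAt_generating_right hq.ne' z.1 ha hκ).congr_fderiv (congrArg _ ?_)
  rw [rho_action hq hz, mul_K_sq_div_four_mul hw hι, norm_action hq hz, inner_fst_action hq hz,
    angle, drift]
  congr 2
  · field_simp
    ring
  · field_simp
    ring

lemma generatedAt_actionAngle (hq : 0 < q) (hz : 0 < ‖z.1‖)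
    (hι : ι = 1 ∧ 1 < orbitParam q z ∨ ι = -1 ∧ orbitParam q z < 1) :
    GeneratedAt q ι (actionAngle q) z :=
  ⟨hasFDerivAt_generating_action_left hq hz hι, hasFDerivAt_generating_action_right hq hz hι⟩

end

/-! ### Euclidean three-space -/

lemma canonicalForm_eq_symplecticForm (ξ ζ : Kepler.E3 × Kepler.E3) :
    Kepler.canonicalForm ξ ζ = symplecticForm ξ ζ := by
  simp only [Kepler.canonicalForm, symplecticForm, PiLp.inner_apply,
    Finset.sum_sub_distrib, RCLike.inner_apply, conj_trivial, mul_comm]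

lemma cross_eq_cross {x v ϑ a : Kepler.E3}
    (h : ∀ B : Kepler.E3 →ₗ[ℝ] Kepler.E3 →ₗ[ℝ] Fin 3 → ℝ, B.IsAlt → B x v = B ϑ a) :
    Kepler.cross x v = Kepler.cross ϑ a :=
  let ofLp := (WithLp.linearEquiv 2 ℝ (Fin 3 → ℝ)).toLinearMap
  congrArg (WithLp.toLp 2) (h (crossProduct.compl₁₂ ofLp ofLp) fun _ => cross_self _)

lemma norm_cross_sq (x v : Kepler.E3) : ‖Kepler.cross x v‖ ^ 2 = gramDet x v := by
  rw [gramDet, sq (inner ℝ x v)]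
  simp only [norm_sq_eq_re_inner (𝕜 := ℝ), RCLike.re_to_real, star_trivial, Kepler.cross,
    EuclideanSpace.inner_eq_star_dotProduct, cross_dot_cross, dotProduct_comm v.ofLp x.ofLp]

lemma foldFunction_eq_foldFunction (q : ℝ) (x v : Kepler.E3) :
    Kepler.foldFunction q x v = foldFunction q (x, v) := by
  rw [Kepler.foldFunction, norm_cross_sq]
  rfl

lemma solvesKeplerOn_iff_isIntegralCurveOn {q : ℝ} {I : Set ℝ} {x v : ℝ → Kepler.E3} :
    Kepler.SolvesKeplerOn q I x v ↔
      IsIntegralCurveOn (fun t => (x t, v t)) (fun _ => keplerField q) I :=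
  forall₂_congr fun _ _ => ⟨fun h => h.1.prodMk h.2, fun h => ⟨h.fst, h.snd⟩⟩

end RepulsiveKepler

open RepulsiveKepler in
theorem mainTheorem2_general.{u, w} {E : Type u} [NormedAddCommGroup E] [InnerProductSpace ℝ E]
    {q : ℝ} (hq : 0 < q) :
    ∃ T : PartialEquiv (E × E) (E × E),
      (T.source = {z | 0 < ‖z.1‖} ∧ T.target = {y | 0 < ‖y.2‖} ∧
        ContDiffOn ℝ ∞ T T.source ∧ ContDiffOn ℝ ∞ T.symm T.target) ∧
      (∀ z : E × E, 0 < ‖z.1‖ → ∀ ξ ζ : E × E,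
        symplecticForm (fderiv ℝ T z ξ) (fderiv ℝ T z ζ) = symplecticForm ξ ζ) ∧
      (∀ z : E × E, 0 < ‖z.1‖ → ‖z.2‖ ^ 2 + q / ‖z.1‖ = ‖(T z).2‖ ^ 2 ∧
        ∀ {F : Type w} [AddCommGroup F] [Module ℝ F] (B : E →ₗ[ℝ] E →ₗ[ℝ] F), B.IsAlt →
          B z.1 z.2 = B (T z).1 (T z).2) ∧
      (∀ I : Set ℝ, I.OrdConnected → (0 : ℝ) ∈ I →
        ∀ γ : ℝ → E × E, (∀ t ∈ I, 0 < ‖(γ t).1‖) →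
          (IsIntegralCurveOn γ (fun _ => keplerField q) I ↔
            ∀ t ∈ I, (T (γ t)).1 = (T (γ 0)).1 + t • (T (γ 0)).2 ∧ (T (γ t)).2 = (T (γ 0)).2)) ∧
      (∀ ϑ a : E, 0 < ‖a‖ →
        (fun t : ℝ => ‖(T.symm (ϑ + t • a, a)).1 - t • a‖) =o[atTop] (fun t : ℝ => t) ∧
        (fun t : ℝ => ‖(T.symm (ϑ + t • a, a)).2 - a‖) =o[atTop] (fun _ : ℝ => (1 : ℝ))) ∧
      (∀ z : E × E, 0 < ‖z.1‖ →
        1 ≤ rho q z.1 (T z).2 ∧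
        (rho q z.1 (T z).2 = 1 ↔ foldFunction q z = 0) ∧
        (foldFunction q z < 0 → GeneratedAt q (-1) T z) ∧
        (0 < foldFunction q z → GeneratedAt q 1 T z)) := by
  refine ⟨actionAngleEquiv E hq, ⟨rfl, rfl,
    fun _ hz => (contDiffAt_actionAngle hq hz).contDiffWithinAt,
    fun _ hy => (contDiffAt_ofActionAngle hq hy).contDiffWithinAt⟩,
    fun _ hz => symplecticForm_fderiv_actionAngle hq hz, fun z hz => ⟨?_, ?_⟩,
    fun I hI h0 γ hγ => ⟨?_, ?_⟩, fun ϑ a ha => ⟨?_, ?_⟩,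
    fun z hz => ⟨?_, ?_, fun h => ?_, fun h => ?_⟩⟩
  · exact ((congrArg (· ^ 2) (norm_action hq hz)).trans (speed_sq hq hz)).symm
  · exact fun B hB => (apply_angle_action hB hq hz).symm
  · exact fun h t ht => actionAngle_of_isIntegralCurveOn hq hI h0 hγ h ht
  · exact isIntegralCurveOn_of_actionAngle hq hγ (norm_snd_actionAngle_pos hq (hγ 0 h0))
  · exact isLittleO_position_sub_smul hq ϑ ha
  · exact (isLittleO_one_iff ℝ).2 (tendsto_velocity_sub hq ϑ ha)
  · exact one_le_rho_action hq hz
  · exact (rho_action_eq_one_iff hq hz).trans (foldFunction_eq_zero_iff hq hz).symm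
  · exact generatedAt_actionAngle hq hz (.inr ⟨rfl, (foldFunction_neg_iff hq hz).1 h⟩)
  · exact generatedAt_actionAngle hq hz (.inl ⟨rfl, (foldFunction_pos_iff hq hz).1 h⟩)

theorem mainTheorem2 (q : ℝ) (hq : 0 < q) :
    ∃ T : PartialEquiv (Kepler.E3 × Kepler.E3) (Kepler.E3 × Kepler.E3),
      -- `T` is a smooth diffeomorphism between the two phase spaces
      (T.source = Kepler.physicalPhaseSpace ∧
        T.target = Kepler.actionAnglePhaseSpace ∧
        ContDiffOn ℝ ∞ T T.source ∧
        ContDiffOn ℝ ∞ T.symm T.target) ∧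
      -- it is canonical
      Kepler.IsCanonicalOn T Kepler.physicalPhaseSpace ∧
      -- it is compatible with conservation of energy and of angular momentum
      (∀ x v : Kepler.E3, 0 < ‖x‖ →
        Kepler.energy q x v = ‖(T (x, v)).2‖ ^ 2 ∧
        Kepler.cross x v = Kepler.cross (T (x, v)).1 (T (x, v)).2) ∧
      -- it linearizes the flow
      (∀ I : Set ℝ, I.OrdConnected → (0 : ℝ) ∈ I →
        ∀ x v : ℝ → Kepler.E3, (∀ t ∈ I, 0 < ‖x t‖) →
          (Kepler.SolvesKeplerOn q I x v ↔
            ∀ t ∈ I, (T (x t, v t)).1 = (T (x 0, v 0)).1 + t • (T (x 0, v 0)).2 ∧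
              (T (x t, v t)).2 = (T (x 0, v 0)).2)) ∧
      -- it has the asymptotic action property
      (∀ ϑ a : Kepler.E3, 0 < ‖a‖ →
        (fun t : ℝ => ‖(T.symm (ϑ + t • a, a)).1 - t • a‖) =o[atTop] (fun t : ℝ => t) ∧
        (fun t : ℝ => ‖(T.symm (ϑ + t • a, a)).2 - a‖) =o[atTop] (fun _ : ℝ => (1 : ℝ))) ∧
      -- it is generated by `S_-` before the fold and by `S_+` after the fold
      (∀ x v : Kepler.E3, 0 < ‖x‖ →
        1 ≤ Kepler.rho q x (T (x, v)).2 ∧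
        (Kepler.rho q x (T (x, v)).2 = 1 ↔ Kepler.foldFunction q x v = 0) ∧
        (Kepler.foldFunction q x v < 0 → Kepler.GeneratedAt q (-1) T x v) ∧
        (0 < Kepler.foldFunction q x v → Kepler.GeneratedAt q 1 T x v)) := by
  obtain ⟨T, hdiffeo, hcanonical, hconserved, hflow, hasymptotic, hgenerated⟩ :=
    mainTheorem2_general (E := Kepler.E3) hq
  exact ⟨T, hdiffeo,
    fun z hz ξ ζ => by
      simpa only [RepulsiveKepler.canonicalForm_eq_symplecticForm] using hcanonical z hz ξ ζ,
    fun x v hx => (hconserved (x, v) hx).imp_right fun h => RepulsiveKepler.cross_eq_cross (h ·),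
    fun I hI h0 _ _ hx =>
      RepulsiveKepler.solvesKeplerOn_iff_isIntegralCurveOn.trans (hflow I hI h0 _ hx),
    hasymptotic,
    fun x v hx => RepulsiveKepler.foldFunction_eq_foldFunction q x v ▸ hgenerated (x, v) hx⟩
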